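/- Work on $[0,\infty)$ with Lebesgue measure $\lambda$; $\mathfrak M$ denotes the real-valued measurable functions on it. For $f\in\mathfrak M$ and $t>0$ put $$f^*(t)=\inf\{s>0:\lambda(\{|f|>s\})\le t\},\qquad f^{**}(t)=\frac1t\int_0^t f^*(s)\,ds .$$ A mapping $\|\cdot\|:\mathfrak M\to[0,\infty]$ is a rearrangement-invariant (r.i.) norm if, for all $f,g,f_n\in\mathfrak M$, $a\in\mathbb R$ and measurable $E\subset[0,\infty)$: (P1) $\|f+g\|\le\|f\|+\|g\|$, $\|af\|=|a|\|f\|$, and $\|f\|=0$ iff $f=0$ a.e.; (P2) $0\le g\le f$ a.e. implies $\|g\|\le\|f\|$; (P3) $0\le f_n\uparrow f$ a.e. implies $\|f_n\|\uparrow\|f\|$; (P4) $\lambda(E)<\infty$ implies $\|\chi_E\|<\infty$; (P5) if $\lambda(E)<\infty$, there is $C_E\in(0,\infty)$ with $\int_E f\,d\lambda\le C_E\|f\|$ for all $f\ge0$; (P6) $f^*=g^*$ implies $\|f\|=\|g\|$. An r.i. norm is $p$-homogeneous if $\|f(r\,\cdot)\|=r^{-1/p}\|f\|$ for all $r>0$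 and all $f\in\mathfrak M$ with $\|f\|<\infty$. A weight is a nonnegative locally integrable function on $[0,\infty)$. Two functionals $A,B:\mathfrak M\to[0,\infty]$ are equivalent if there is $C\in(0,\infty)$ with $C^{-1}A(f)\le B(f)\le C\,A(f)$ for all $f\in\mathfrak M$. **Proposition.** Let $p\in(1,\infty)$, $q\in[1,\infty)$ and let $w$ be a weight. Put $$\|f\|_{\Gamma^q(w)}=\Big(\int_0^\infty (f^{**}(t))^q\,w(t)\,dt\Big)^{1/q},\qquad \|f\|_{p,q}=\Big(\int_0^\infty (f^{*}(t))^q\,t^{\frac qp-1}\,dt\Big)^{1/q},$$ $$\|f\|_{(p,q)}=\Big(\int_0^\infty (f^{**}(t))^q\,t^{\frac qp-1}\,dt\Big)^{1/q},$$ $\Gamma^q(w)=\{f\in\mathfrak M:\|f\|_{\Gamma^q(w)}<\infty\}$ and $L^{p,q}=\{f\in\mathfrak M:\|f\|_{(p,q)}<\infty\}$. Then $\|\cdot\|_{\Gamma^q(w)}$ is equivalent to a $p$-homogeneous r.i. norm if and only if it is equivalent to $\|\cdot\|_{p,q}$; and the latter holds if and only if $\Gamma^q(w)=L^{p,q}$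 as sets of functions. -/

import Mathlib

open MeasureTheory Set Filter Topology
open scoped ENNReal NNReal

noncomputable section

namespace RILorentz

/-- The measure space `[0,∞)` with Lebesgue measure. The space `𝔐([0,∞))` of real-valued measurable
functions on it consists of the `f : ℝ → ℝ` with `AEMeasurable f halfLine`; the values of `f` on the
negative half-axis are irrelevant. -/
def halfLine : Measure ℝ := volume.restrict (Ici 0)

/-- The nonincreasing rearrangement `f^*(t) = inf {s > 0 : λ{|f| > s} ≤ t}`, where the infimum of
the empty set is `∞`. -/
def rearr (f : ℝ → ℝ) (t : ℝ) : ℝ≥0∞ :=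
  ⨅ (s : ℝ≥0) (_ : 0 < s ∧ halfLine {x | (s : ℝ) < |f x|} ≤ ENNReal.ofReal t), (s : ℝ≥0∞)

/-- The maximal function `f^{**}(t) = (1/t) ∫_0^t f^*(s) ds`, for `t > 0`. -/
def maxRearr (f : ℝ → ℝ) (t : ℝ) : ℝ≥0∞ :=
  (ENNReal.ofReal t)⁻¹ * ∫⁻ s in Ioc 0 t, rearr f s

/-- Rearrangement-invariant norms `𝔐([0,∞)) → [0,∞]`. -/
structure IsRINorm (N : (ℝ → ℝ) → ℝ≥0∞) : Prop where
  triangle : ∀ f g, AEMeasurable f halfLine → AEMeasurable g halfLine → N (f + g) ≤ N f + N g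
  smul : ∀ (a : ℝ) (f : ℝ → ℝ), AEMeasurable f halfLine → N (a • f) = ENNReal.ofReal |a| * N f
  eq_zero_iff : ∀ f, AEMeasurable f halfLine → (N f = 0 ↔ f =ᵐ[halfLine] 0)
  mono : ∀ f g, AEMeasurable f halfLine → AEMeasurable g halfLine →
    (∀ᵐ x ∂halfLine, 0 ≤ g x ∧ g x ≤ f x) → N g ≤ N f
  fatou : ∀ (fn : ℕ → ℝ → ℝ) (f : ℝ → ℝ), (∀ n, AEMeasurable (fn n) halfLine) →
    AEMeasurable f halfLine →
    (∀ᵐ x ∂halfLine, (∀ n, 0 ≤ fn n x) ∧ Monotone (fun n => fn n x) ∧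
      Tendsto (fun n => fn n x) atTop (𝓝 (f x))) →
    Monotone (fun n => N (fn n)) ∧ Tendsto (fun n => N (fn n)) atTop (𝓝 (N f))
  indicator_lt_top : ∀ E : Set ℝ, NullMeasurableSet E halfLine → halfLine E < ∞ →
    N (E.indicator fun _ => 1) < ∞
  local_integral : ∀ E : Set ℝ, NullMeasurableSet E halfLine → halfLine E < ∞ →
    ∃ C : ℝ≥0, 0 < C ∧ ∀ f, AEMeasurable f halfLine → (∀ᵐ x ∂halfLine, 0 ≤ f x) →
      ∫⁻ x in E, ENNReal.ofReal (f x) ∂halfLine ≤ C * N f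
  rearr_invariant : ∀ f g, AEMeasurable f halfLine → AEMeasurable g halfLine →
    (∀ t, 0 < t → rearr f t = rearr g t) → N f = N g

/-- The dilation operator `D_r f (t) = f (r t)`. -/
def dilation (r : ℝ) (f : ℝ → ℝ) : ℝ → ℝ := fun t => f (r * t)

/-- `N` is a `p`-homogeneous rearrangement-invariant norm (for finite `p`): an r.i. norm with
`N (D_r f) = r^{-1/p} N f` for all `r > 0` and all `f` in the space generated by `N`. -/
structure IsHomogeneousRINorm (p : ℝ) (N : (ℝ → ℝ) → ℝ≥0∞) : Prop where
  isRINorm : IsRINorm N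
  homogeneous : ∀ f, AEMeasurable f halfLine → N f < ∞ → ∀ r : ℝ, 0 < r →
    N (dilation r f) = ENNReal.ofReal (r ^ (-1 / p)) * N f

/-- Weights: nonnegative locally integrable (hence Lebesgue measurable) functions on `[0,∞)`. -/
structure IsWeight (w : ℝ → ℝ) : Prop where
  nonneg : ∀ t, 0 ≤ t → 0 ≤ w t
  locallyIntegrable : LocallyIntegrableOn w (Ici 0)

/-- `‖f‖_{Γ^q(w)} = (∫_0^∞ (f^{**}(t))^q w(t) dt)^{1/q}`. -/
def gammaNorm (q : ℝ) (w : ℝ → ℝ) (f : ℝ → ℝ) : ℝ≥0∞ :=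
  (∫⁻ t in Ioi (0 : ℝ), maxRearr f t ^ q * ENNReal.ofReal (w t)) ^ (1 / q)

/-- `‖f‖_{p,q} = (∫_0^∞ (f^*(t))^q t^{q/p-1} dt)^{1/q}`, for finite `q`. -/
def lorentzNorm (p q : ℝ) (f : ℝ → ℝ) : ℝ≥0∞ :=
  (∫⁻ t in Ioi (0 : ℝ), rearr f t ^ q * ENNReal.ofReal (t ^ (q / p - 1))) ^ (1 / q)

/-- `‖f‖_{(p,q)} = (∫_0^∞ (f^{**}(t))^q t^{q/p-1} dt)^{1/q}`, for finite `q`. -/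
def lorentzMaxNorm (p q : ℝ) (f : ℝ → ℝ) : ℝ≥0∞ :=
  (∫⁻ t in Ioi (0 : ℝ), maxRearr f t ^ q * ENNReal.ofReal (t ^ (q / p - 1))) ^ (1 / q)

/-- The weighted Lorentz space `Γ^q(w)`. -/
def gammaSpace (q : ℝ) (w : ℝ → ℝ) : Set (ℝ → ℝ) :=
  {f | AEMeasurable f halfLine ∧ gammaNorm q w f < ∞}

/-- The Lorentz space `L^{p,q}`, the set of measurable `f` with `‖f‖_{(p,q)} < ∞`. -/
def lorentzSpace (p q : ℝ) : Set (ℝ → ℝ) :=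
  {f | AEMeasurable f halfLine ∧ lorentzMaxNorm p q f < ∞}

/-- Equivalence of functionals on `𝔐([0,∞))`, with a constant independent of the function. -/
def Equivalent (A B : (ℝ → ℝ) → ℝ≥0∞) : Prop :=
  ∃ C : ℝ≥0, 0 < C ∧ ∀ f, AEMeasurable f halfLine → A f ≤ C * B f ∧ B f ≤ C * A f

end RILorentz

end

/-!
All norms here that involve `f^{**}` are instances of `maxNorm q μ f`, the `L^q(μ)` norm of
`f^{**}`: `Γ^q(w)` uses `μ = w(t) dt` and `L^{p,q}` uses `π = t^{q/p-1} dt`, both on `(0,∞)`.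

The functional for `π` is itself a `p`-homogeneous r.i. norm (`isHomogeneousRINorm_maxNorm`):
the triangle inequality comes from `(f + g)^{**} ≤ f^{**} + g^{**}` (`maxRearr_add_le`), which
follows from `∫_0^t f^* = min_c (∫ (|f| - c)_+ + t c)`, and homogeneity is a change of variables. By Hardy's
inequality (`exists_lorentzMaxNorm_le`), obtained by cutting `(0, t]` dyadically, it is equivalent
to `‖·‖_{p,q}`.

If `Γ^q(w)` is equivalent to some `p`-homogeneous r.i. norm `N`, homogeneity is applied only to
characteristic functions: it makes the norm of `χ_{[0,a]}` comparable to `a^{1/p}`, so that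
`∫ min(1, a/t)^q w(t) dt` is comparable to `a^{q/p}`. As `0 < q/p < q`, the parts `t ≤ a/M` and
`t ≥ aM` of this integral contribute little, whence `w` has mass comparable to `s^{q/p}` on
`(s/M, sM)` for a large `M` (`exists_le_measure_Ioo`). Since `f^{**}(t)` decreases and `t f^{**}(t)`
increases, `f^{**}` is constant up to a factor `M` on such intervals, and averaging over them by
Tonelli's theorem shows that the norms for `w(t) dt` and `π` are equivalent
(`exists_lintegral_comparison`).

Finally, if the two spaces coincide as sets, the norms are equivalent, because the norms have the
Fatou property: functions violating every bound could be summed to a function lying in only one of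
the spaces (`exists_maxNorm_le_of_subset`). The zero weight, for which `maxNorm` is not a norm, is
excluded by the constant function `1`.
-/

noncomputable section

namespace RILorentz

/-! ### Distribution function, rearrangement and maximal function -/

/-- The distribution function `s ↦ λ{|f| > s}` of `f`. -/
def distrib (f : ℝ → ℝ) (s : ℝ) : ℝ≥0∞ := halfLine {x | s < |f x|}

lemma distrib_antitone (f : ℝ → ℝ) : Antitone (distrib f) := fun _ _ h =>
  measure_mono fun _ hx => lt_of_le_of_lt h hx

lemma distrib_mono {f g : ℝ → ℝ} (h : ∀ᵐ x ∂halfLine, |g x| ≤ |f x|) (s : ℝ) :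
    distrib g s ≤ distrib f s :=
  measure_mono_ae <| h.mono fun _ hx (hs : s < _) => hs.trans_le hx

/-- The distribution function is right-continuous. -/
lemma distrib_le_of_forall_lt {f : ℝ → ℝ} {s : ℝ} {m : ℝ≥0∞}
    (h : ∀ s', s < s' → distrib f s' ≤ m) : distrib f s ≤ m := by
  have hU : {x | s < |f x|} = ⋃ n : ℕ, {x | s + 1 / ((n : ℝ) + 1) < |f x|} := by
    ext x
    simp only [mem_ofPred_eq, mem_iUnion]
    constructor
    · intro hx
      obtain ⟨n, hn⟩ := exists_nat_one_div_lt (sub_pos.2 hx)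
      exact ⟨n, by linarith⟩
    · rintro ⟨n, hn⟩
      have : (0 : ℝ) < 1 / ((n : ℝ) + 1) := by positivity
      linarith
  have hmono : Monotone fun n : ℕ => {x | s + 1 / ((n : ℝ) + 1) < |f x|} := by
    intro m n hmn x hx
    have := one_div_le_one_div_of_le (by positivity : (0 : ℝ) < (m : ℝ) + 1)
      (by exact_mod_cast Nat.succ_le_succ hmn : (m : ℝ) + 1 ≤ (n : ℝ) + 1)
    simp only [mem_ofPred_eq] at hx ⊢
    linarith
  rw [distrib, hU, hmono.measure_iUnion]
  exact iSup_le fun n => h _ (by simp; positivity)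

/-- The rearrangement is the generalized inverse of the distribution function. -/
lemma rearr_le_iff {f : ℝ → ℝ} {t s : ℝ} (hs : 0 ≤ s) :
    rearr f t ≤ ENNReal.ofReal s ↔ distrib f s ≤ ENNReal.ofReal t := by
  have key : ∀ s' : ℝ, 0 < s' → distrib f s' ≤ ENNReal.ofReal t →
      rearr f t ≤ ENNReal.ofReal s' := fun s' h0 h =>
    iInf₂_le (⟨s', h0.le⟩ : ℝ≥0) ⟨h0, h⟩ |>.trans
      (by rw [ENNReal.ofReal_eq_coe_nnreal h0.le]; rfl)
  constructor
  · intro h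
    refine distrib_le_of_forall_lt fun s' hs' => ?_
    have h1 : rearr f t < ENNReal.ofReal s' :=
      h.trans_lt ((ENNReal.ofReal_lt_ofReal_iff (hs.trans_lt hs')).2 hs')
    simp only [rearr, iInf_lt_iff] at h1
    obtain ⟨r, ⟨_, hr⟩, hlt⟩ := h1
    refine (distrib_antitone f ?_).trans hr
    exact (ENNReal.le_ofReal_iff_toReal_le ENNReal.coe_ne_top (hs.trans hs'.le)).1 hlt.le
  · intro h
    refine ENNReal.le_of_forall_pos_le_add fun ε hε _ => ?_
    have := key (s + ε) (by positivity) ((distrib_antitone f (by simp)).trans h)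
    rwa [ENNReal.ofReal_add hs ε.coe_nonneg, ENNReal.ofReal_coe_nnreal] at this

lemma lt_rearr_iff {f : ℝ → ℝ} {t s : ℝ} (hs : 0 ≤ s) :
    ENNReal.ofReal s < rearr f t ↔ ENNReal.ofReal t < distrib f s := by
  rw [← not_le, ← not_le, rearr_le_iff hs]

lemma rearr_antitone (f : ℝ → ℝ) : Antitone (rearr f) := by
  intro t t' htt'
  refine ENNReal.le_of_forall_nnreal_lt fun r hr => ?_
  rw [← ENNReal.ofReal_coe_nnreal, lt_rearr_iff r.coe_nonneg] at hr
  rw [← ENNReal.ofReal_coe_nnreal]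
  exact ((lt_rearr_iff r.coe_nonneg).2 ((ENNReal.ofReal_le_ofReal htt').trans_lt hr)).le

lemma measurable_rearr (f : ℝ → ℝ) : Measurable (rearr f) := (rearr_antitone f).measurable

/-- The layer-cake formula for a constant in `[0, ∞]`. -/
lemma lintegral_ofReal_lt (a : ℝ≥0∞) :
    ∫⁻ s in Ioi (0 : ℝ), {s : ℝ | ENNReal.ofReal s < a}.indicator 1 s = a := by
  have hm : MeasurableSet {s : ℝ | ENNReal.ofReal s < a} :=
    measurableSet_lt ENNReal.measurable_ofReal measurable_const
  rw [lintegral_indicator_one hm, Measure.restrict_apply hm]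
  rcases eq_or_ne a ∞ with rfl | ha
  · simp
  · have : {s : ℝ | ENNReal.ofReal s < a} ∩ Ioi 0 = Ioo 0 a.toReal := by
      ext s
      simp only [mem_inter_iff, mem_ofPred_eq, mem_Ioi, mem_Ioo]
      constructor
      · rintro ⟨h, h0⟩
        exact ⟨h0, (ENNReal.ofReal_lt_iff_lt_toReal h0.le ha).1 h⟩
      · rintro ⟨h0, h⟩
        exact ⟨(ENNReal.ofReal_lt_iff_lt_toReal h0.le ha).2 h, h0⟩
    rw [this, Real.volume_Ioo, sub_zero, ENNReal.ofReal_toReal ha]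

lemma lintegral_Ioc_ofReal_lt (t : ℝ) (a : ℝ≥0∞) :
    ∫⁻ x in Ioc (0 : ℝ) t, {x : ℝ | ENNReal.ofReal x < a}.indicator 1 x
      = min (ENNReal.ofReal t) a := by
  have hm : MeasurableSet {s : ℝ | ENNReal.ofReal s < a} :=
    measurableSet_lt ENNReal.measurable_ofReal measurable_const
  rw [lintegral_indicator_one hm, Measure.restrict_apply hm]
  rcases lt_or_ge (ENNReal.ofReal t) a with h | h
  · have : {s : ℝ | ENNReal.ofReal s < a} ∩ Ioc 0 t = Ioc 0 t :=
      inter_eq_right.2 fun x hx => (ENNReal.ofReal_le_ofReal hx.2).trans_lt h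
    rw [this, Real.volume_Ioc, sub_zero, min_eq_left h.le]
  · have ha : a ≠ ∞ := ne_top_of_le_ne_top ENNReal.ofReal_ne_top h
    have : {s : ℝ | ENNReal.ofReal s < a} ∩ Ioc 0 t = Ioo 0 a.toReal := by
      ext s
      simp only [mem_inter_iff, mem_ofPred_eq, mem_Ioc, mem_Ioo]
      constructor
      · rintro ⟨h, h0, _⟩
        exact ⟨h0, (ENNReal.ofReal_lt_iff_lt_toReal h0.le ha).1 h⟩
      · rintro ⟨h0, h'⟩
        have h2 := (ENNReal.ofReal_lt_iff_lt_toReal h0.le ha).2 h'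
        exact ⟨h2, h0, (ENNReal.ofReal_lt_ofReal_iff'.1 (h2.trans_le h)).1.le⟩
    rw [this, Real.volume_Ioo, sub_zero, ENNReal.ofReal_toReal ha, min_eq_right h]

/-- Both sides are the area of `{(x, s) : 0 < x ≤ t, 0 < s < f^*(x)}`. -/
lemma lintegral_rearr (f : ℝ → ℝ) (t : ℝ) :
    ∫⁻ x in Ioc 0 t, rearr f x
      = ∫⁻ s in Ioi (0 : ℝ), min (ENNReal.ofReal t) (distrib f s) := by
  have hm : Measurable (Function.uncurry fun x s : ℝ =>
      {s : ℝ | ENNReal.ofReal s < rearr f x}.indicator (1 : ℝ → ℝ≥0∞) s) := by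
    have : MeasurableSet {z : ℝ × ℝ | ENNReal.ofReal z.2 < rearr f z.1} :=
      measurableSet_lt measurable_snd.ennreal_ofReal ((measurable_rearr f).comp measurable_fst)
    exact (measurable_one (α := ℝ≥0∞)).indicator this
  calc ∫⁻ x in Ioc 0 t, rearr f x
      = ∫⁻ x in Ioc 0 t, ∫⁻ s in Ioi (0 : ℝ),
          {s : ℝ | ENNReal.ofReal s < rearr f x}.indicator 1 s := by
        simp only [lintegral_ofReal_lt]
    _ = ∫⁻ s in Ioi (0 : ℝ), ∫⁻ x in Ioc 0 t,
          {s : ℝ | ENNReal.ofReal s < rearr f x}.indicator 1 s :=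
        lintegral_lintegral_swap hm.aemeasurable
    _ = ∫⁻ s in Ioi (0 : ℝ), min (ENNReal.ofReal t) (distrib f s) := by
        refine setLIntegral_congr_fun measurableSet_Ioi fun s (hs : 0 < s) => ?_
        rw [← lintegral_Ioc_ofReal_lt]
        refine lintegral_congr fun x => ?_
        simp only [indicator_apply, mem_ofPred_eq, lt_rearr_iff hs.le, Pi.one_apply]

lemma maxRearr_eq (f : ℝ → ℝ) (t : ℝ) :
    maxRearr f t = (ENNReal.ofReal t)⁻¹ *
      ∫⁻ s in Ioi (0 : ℝ), min (ENNReal.ofReal t) (distrib f s) := by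
  rw [maxRearr, lintegral_rearr]

/-- The junk value at `t ≤ 0` is `∞ * 0 = 0`, so the points of `(-∞, 0]` never contribute to an
integral of a power of `f^{**}`. -/
lemma maxRearr_of_nonpos (f : ℝ → ℝ) {t : ℝ} (ht : t ≤ 0) : maxRearr f t = 0 := by
  simp [maxRearr, Ioc_eq_empty_of_le ht]

lemma lintegral_rearr_eq_mul (f : ℝ → ℝ) {t : ℝ} (ht : 0 < t) :
    ∫⁻ x in Ioc 0 t, rearr f x = ENNReal.ofReal t * maxRearr f t := by
  rw [maxRearr, ← mul_assoc, ENNReal.mul_inv_cancel (by simpa using ht) ENNReal.ofReal_ne_top,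
    one_mul]

lemma measurable_maxRearr (f : ℝ → ℝ) : Measurable (maxRearr f) := by
  have : Monotone fun t => ∫⁻ s in Ioc 0 t, rearr f s := fun a b hab =>
    lintegral_mono_set (Ioc_subset_Ioc_right hab)
  exact ENNReal.measurable_ofReal.inv.mul this.measurable

lemma maxRearr_mono {f g : ℝ → ℝ} (h : ∀ᵐ x ∂halfLine, |g x| ≤ |f x|) (t : ℝ) :
    maxRearr g t ≤ maxRearr f t := by
  rw [maxRearr_eq, maxRearr_eq]
  gcongr with s
  exact distrib_mono h s

/-- `t ↦ t f^{**}(t)` is nondecreasing. -/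
lemma mul_maxRearr_le (f : ℝ → ℝ) {a t : ℝ} (ha : 0 < a) (hat : a ≤ t) :
    ENNReal.ofReal (a / t) * maxRearr f a ≤ maxRearr f t := by
  have ht := ha.trans_le hat
  have h1 : ENNReal.ofReal a * maxRearr f a ≤ ENNReal.ofReal t * maxRearr f t := by
    rw [← lintegral_rearr_eq_mul f ha, ← lintegral_rearr_eq_mul f ht]
    exact lintegral_mono_set (Ioc_subset_Ioc_right hat)
  rw [ENNReal.ofReal_div_of_pos ht, ENNReal.div_eq_inv_mul, mul_assoc]
  calc _ ≤ (ENNReal.ofReal t)⁻¹ * (ENNReal.ofReal t * maxRearr f t) := by gcongr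
    _ = maxRearr f t := by
      rw [← mul_assoc, ENNReal.inv_mul_cancel (by simpa using ht) ENNReal.ofReal_ne_top, one_mul]

/-- `f^{**}` is nonincreasing on `(0, ∞)`. -/
lemma maxRearr_antitoneOn (f : ℝ → ℝ) : AntitoneOn (maxRearr f) (Ioi 0) := by
  intro a (ha : 0 < a) t (ht : 0 < t) hat
  rw [maxRearr_eq, maxRearr_eq, ← lintegral_const_mul' _ _ (by simpa using ht),
    ← lintegral_const_mul' _ _ (by simpa using ha)]
  refine lintegral_mono fun s => ?_
  have h0 : ENNReal.ofReal a ≠ 0 := by simpa using ha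
  have h1 : ENNReal.ofReal t ≠ 0 := by simpa using ht
  rw [mul_min, mul_min, ENNReal.inv_mul_cancel h0 ENNReal.ofReal_ne_top,
    ENNReal.inv_mul_cancel h1 ENNReal.ofReal_ne_top]
  gcongr

lemma rearr_le_maxRearr (f : ℝ → ℝ) {t : ℝ} (ht : 0 < t) : rearr f t ≤ maxRearr f t := by
  have h0 : ENNReal.ofReal t ≠ 0 := by simpa using ht
  have h : ∫⁻ _ in Ioc 0 t, rearr f t ≤ ∫⁻ x in Ioc 0 t, rearr f x :=
    setLIntegral_mono' measurableSet_Ioc fun x hx => rearr_antitone f hx.2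
  rw [setLIntegral_const, Real.volume_Ioc, sub_zero] at h
  calc rearr f t = (ENNReal.ofReal t)⁻¹ * (rearr f t * ENNReal.ofReal t) := by
        rw [mul_comm, mul_assoc, ENNReal.mul_inv_cancel h0 ENNReal.ofReal_ne_top, mul_one]
    _ ≤ maxRearr f t := by rw [maxRearr]; gcongr

/-! ### Subadditivity, scaling and monotone convergence of the maximal function -/

lemma lintegral_Ioi_comp_mul {F : ℝ → ℝ≥0∞} {r : ℝ} (hr : 0 < r) :
    ∫⁻ t in Ioi (0 : ℝ), F (r * t) = ENNReal.ofReal r⁻¹ * ∫⁻ t in Ioi (0 : ℝ), F t := by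
  have he : MeasurableEmbedding fun t : ℝ => r * t :=
    (Homeomorph.mulLeft₀ r hr.ne').measurableEmbedding
  have h1 : ∀ t, (Ioi (0 : ℝ)).indicator (fun t => F (r * t)) t
      = (Ioi (0 : ℝ)).indicator F (r * t) := by
    intro t
    simp only [indicator_apply, mem_Ioi, mul_pos_iff_of_pos_left hr]
  rw [← lintegral_indicator measurableSet_Ioi, ← lintegral_indicator measurableSet_Ioi,
    lintegral_congr h1, ← he.lintegral_map, Real.map_volume_mul_left hr.ne',
    lintegral_smul_measure, abs_of_pos (inv_pos.2 hr), smul_eq_mul]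

lemma lintegral_excess {f : ℝ → ℝ} (hf : AEMeasurable f halfLine) (c : ℝ) :
    ∫⁻ x, ENNReal.ofReal (|f x| - c) ∂halfLine = ∫⁻ s in Ioi c, distrib f s := by
  have h1 : ∀ x, ENNReal.ofReal (|f x| - c) = ENNReal.ofReal (max (|f x| - c) 0) := fun x => by
    rcases le_total (|f x| - c) 0 with h | h
    · rw [max_eq_right h, ENNReal.ofReal_of_nonpos h, ENNReal.ofReal_zero]
    · rw [max_eq_left h]
  have hm : AEMeasurable (fun x => max (|f x| - c) 0) halfLine :=
    (hf.abs.sub_const c).max aemeasurable_const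
  rw [lintegral_congr h1, lintegral_eq_lintegral_meas_lt _
    (Eventually.of_forall fun x => le_max_right (|f x| - c) (0 : ℝ)) hm,
    ← lintegral_indicator measurableSet_Ioi, ← lintegral_indicator measurableSet_Ioi,
    ← lintegral_sub_right_eq_self _ c]
  refine lintegral_congr fun s => ?_
  simp only [indicator_apply, mem_Ioi, sub_pos]
  split_ifs with h
  · rw [distrib]
    congr 1
    ext x
    simp only [mem_ofPred_eq, lt_max_iff]
    constructor
    · rintro (h' | h') <;> linarith
    · intro h'
      left; linarith
  · rfl

/-- `∫_0^t f^*` is bounded by the cost `∫ (|f| - c)_+ + t c` of splitting `f` at height `c` into an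
integrable and a bounded part. -/
lemma lintegral_min_le {f : ℝ → ℝ} (hf : AEMeasurable f halfLine) (t : ℝ) {c : ℝ} (hc : 0 ≤ c) :
    ∫⁻ s in Ioi (0 : ℝ), min (ENNReal.ofReal t) (distrib f s)
      ≤ ∫⁻ x, ENNReal.ofReal (|f x| - c) ∂halfLine + ENNReal.ofReal t * ENNReal.ofReal c := by
  rw [lintegral_excess hf, ← Ioc_union_Ioi_eq_Ioi hc, add_comm]
  refine (lintegral_union_le _ _ _).trans (add_le_add ?_ ?_)
  · refine (lintegral_mono fun s => min_le_left _ _).trans ?_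
    rw [setLIntegral_const, Real.volume_Ioc, sub_zero]
  · exact lintegral_mono fun s => min_le_right _ _

/-- The bound of `lintegral_min_le` is attained at the height `c = f^*(t)`. -/
lemma exists_le_lintegral_min {f : ℝ → ℝ} (hf : AEMeasurable f halfLine) {t : ℝ} (ht : 0 < t)
    (hfin : ∫⁻ s in Ioi (0 : ℝ), min (ENNReal.ofReal t) (distrib f s) ≠ ∞) :
    ∃ c : ℝ, 0 ≤ c ∧
      ∫⁻ x, ENNReal.ofReal (|f x| - c) ∂halfLine + ENNReal.ofReal t * ENNReal.ofReal c
        ≤ ∫⁻ s in Ioi (0 : ℝ), min (ENNReal.ofReal t) (distrib f s) := by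
  have htop : rearr f t ≠ ∞ := by
    intro h
    refine hfin ?_
    have : ∀ s ∈ Ioi (0 : ℝ), min (ENNReal.ofReal t) (distrib f s) = ENNReal.ofReal t :=
      fun s hs => min_eq_left
        ((lt_rearr_iff (mem_Ioi.1 hs).le).1 (h ▸ ENNReal.ofReal_lt_top)).le
    rw [setLIntegral_congr_fun measurableSet_Ioi this, setLIntegral_const, Real.volume_Ioi,
      ENNReal.mul_top (by simpa using ht)]
  have hc : 0 ≤ (rearr f t).toReal := ENNReal.toReal_nonneg
  refine ⟨(rearr f t).toReal, hc, ?_⟩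
  have hle : distrib f (rearr f t).toReal ≤ ENNReal.ofReal t :=
    (rearr_le_iff hc).1 (by rw [ENNReal.ofReal_toReal htop])
  have hm : ∀ s, MeasurableSet (Ioi s : Set ℝ) := fun s => measurableSet_Ioi
  rw [← Ioc_union_Ioi_eq_Ioi hc, lintegral_union (hm _) (Ioc_disjoint_Ioi le_rfl),
    lintegral_excess hf, add_comm]
  refine add_le_add ?_ ?_
  · rw [← restrict_Ioo_eq_restrict_Ioc]
    have : ∀ s ∈ Ioo 0 (rearr f t).toReal, ENNReal.ofReal t
        ≤ min (ENNReal.ofReal t) (distrib f s) := fun s hs =>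
      le_min le_rfl ((lt_rearr_iff hs.1.le).1
        ((ENNReal.ofReal_lt_iff_lt_toReal hs.1.le htop).2 hs.2)).le
    refine le_trans (le_of_eq ?_) (setLIntegral_mono' measurableSet_Ioo this)
    rw [setLIntegral_const, Real.volume_Ioo, sub_zero]
  · exact setLIntegral_mono' measurableSet_Ioi fun s hs =>
      le_min ((distrib_antitone f (le_of_lt hs)).trans hle) le_rfl

/-- Heights splitting `f` and `g` optimally add up to an admissible height for `f + g`. -/
lemma maxRearr_add_le {f g : ℝ → ℝ} (hf : AEMeasurable f halfLine) (hg : AEMeasurable g halfLine)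
    (t : ℝ) : maxRearr (f + g) t ≤ maxRearr f t + maxRearr g t := by
  rcases le_or_gt t 0 with ht | ht
  · simp [maxRearr_of_nonpos _ ht]
  rw [maxRearr_eq, maxRearr_eq, maxRearr_eq, ← mul_add]
  gcongr
  by_cases h1 : ∫⁻ s in Ioi (0 : ℝ), min (ENNReal.ofReal t) (distrib f s) = ∞
  · simp [h1]
  by_cases h2 : ∫⁻ s in Ioi (0 : ℝ), min (ENNReal.ofReal t) (distrib g s) = ∞
  · simp [h2]
  obtain ⟨c, hc, hfc⟩ := exists_le_lintegral_min hf ht h1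
  obtain ⟨d, hd, hgd⟩ := exists_le_lintegral_min hg ht h2
  refine (lintegral_min_le (hf.add hg) t (add_nonneg hc hd)).trans ?_
  refine le_trans ?_ (add_le_add hfc hgd)
  rw [ENNReal.ofReal_add hc hd, mul_add, add_add_add_comm]
  gcongr
  rw [← lintegral_add_left' (hf.abs.sub_const c).ennreal_ofReal]
  refine lintegral_mono fun x => ?_
  refine (ENNReal.ofReal_le_ofReal ?_).trans ENNReal.ofReal_add_le
  have := abs_add_le (f x) (g x)
  simp only [Pi.add_apply]
  linarith

lemma maxRearr_zero (t : ℝ) : maxRearr 0 t = 0 := by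
  rw [maxRearr_eq]
  have : ∀ s ∈ Ioi (0 : ℝ), min (ENNReal.ofReal t) (distrib 0 s) = 0 := fun s hs => by
    have : {x : ℝ | s < |(0 : ℝ → ℝ) x|} = ∅ := by
      ext x
      simp [(mem_Ioi.1 hs).le]
    rw [distrib, this, measure_empty, min_zero]
  rw [setLIntegral_congr_fun measurableSet_Ioi this, lintegral_zero, mul_zero]

lemma maxRearr_congr {f g : ℝ → ℝ} (h : ∀ᵐ x ∂halfLine, |g x| = |f x|) (t : ℝ) :
    maxRearr g t = maxRearr f t :=
  le_antisymm (maxRearr_mono (h.mono fun _ hx => hx.le) t)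
    (maxRearr_mono (h.mono fun _ hx => hx.ge) t)

lemma maxRearr_smul (a : ℝ) (f : ℝ → ℝ) (t : ℝ) :
    maxRearr (a • f) t = ENNReal.ofReal |a| * maxRearr f t := by
  rcases eq_or_ne a 0 with rfl | ha
  · simp [maxRearr_zero]
  have ha' : 0 < |a| := abs_pos.2 ha
  have hd : ∀ s, distrib (a • f) s = distrib f (|a|⁻¹ * s) := fun s => by
    simp only [distrib, Pi.smul_apply, smul_eq_mul, abs_mul]
    congr 1
    ext x
    simp only [mem_ofPred_eq]
    rw [inv_mul_lt_iff₀ ha']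
  rw [maxRearr_eq, maxRearr_eq]
  simp only [hd]
  rw [lintegral_Ioi_comp_mul (F := fun s => min (ENNReal.ofReal t) (distrib f s))
    (inv_pos.2 ha'), inv_inv]
  ring

lemma maxRearr_dilation {r : ℝ} (hr : 0 < r) (f : ℝ → ℝ) (t : ℝ) :
    maxRearr (dilation r f) t = maxRearr f (r * t) := by
  have hr0 : ENNReal.ofReal r ≠ 0 := by simpa using hr
  have hd : ∀ s, distrib (dilation r f) s = (ENNReal.ofReal r)⁻¹ * distrib f s := fun s => by
    have : {x | s < |dilation r f x|} ∩ Ici 0 = (r * ·) ⁻¹' ({x | s < |f x|} ∩ Ici 0) := by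
      ext x
      simp [dilation, mul_nonneg_iff_of_pos_left hr]
    rw [distrib, distrib, halfLine, Measure.restrict_apply' measurableSet_Ici,
      Measure.restrict_apply' measurableSet_Ici, this, Real.volume_preimage_mul_left hr.ne',
      abs_of_pos (inv_pos.2 hr), ENNReal.ofReal_inv_of_pos hr]
  have hmin : ∀ s, min (ENNReal.ofReal t) (distrib (dilation r f) s)
      = (ENNReal.ofReal r)⁻¹ * min (ENNReal.ofReal (r * t)) (distrib f s) := fun s => by
    rw [hd, mul_min, ENNReal.ofReal_mul hr.le, ← mul_assoc,
      ENNReal.inv_mul_cancel hr0 ENNReal.ofReal_ne_top, one_mul]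
  rw [maxRearr_eq, maxRearr_eq]
  simp only [hmin]
  rw [lintegral_const_mul' _ _ (ENNReal.inv_ne_top.2 hr0), ENNReal.ofReal_mul hr.le,
    ENNReal.mul_inv (Or.inl hr0) (Or.inl ENNReal.ofReal_ne_top)]
  ring

lemma ae_eq_zero_of_maxRearr_eq_zero {f : ℝ → ℝ} {t : ℝ} (ht : 0 < t) (h : maxRearr f t = 0) :
    f =ᵐ[halfLine] 0 := by
  have h1 : ∀ t', 0 < t' → t' ≤ t → distrib f 0 ≤ ENNReal.ofReal t' := by
    intro t' h0 hle
    have h2 := mul_maxRearr_le f h0 hle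
    rw [h, nonpos_iff_eq_zero, mul_eq_zero, ENNReal.ofReal_eq_zero] at h2
    have h3 : maxRearr f t' = 0 := h2.resolve_left (not_le.2 (div_pos h0 ht))
    refine (rearr_le_iff le_rfl).1 ?_
    exact (rearr_le_maxRearr f h0).trans (by simp [h3])
  have h4 : distrib f 0 = 0 := by
    refine le_antisymm (ENNReal.le_of_forall_pos_le_add fun ε hε _ => ?_) zero_le
    rw [zero_add]
    refine (h1 (min ε t) (lt_min hε ht) (min_le_right _ _)).trans ?_
    refine (ENNReal.ofReal_le_ofReal (min_le_left _ _)).trans ?_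
    rw [ENNReal.ofReal_coe_nnreal]
  filter_upwards [measure_eq_zero_iff_ae_notMem.1 h4] with x hx
  simpa using hx

lemma maxRearr_indicator (E : Set ℝ) (t : ℝ) :
    maxRearr (E.indicator fun _ => 1) t
      = (ENNReal.ofReal t)⁻¹ * min (ENNReal.ofReal t) (halfLine E) := by
  rw [maxRearr_eq]
  congr 1
  have h1 : ∀ s ∈ Ioi (0 : ℝ),
      min (ENNReal.ofReal t) (distrib (E.indicator fun _ => 1) s)
        = (Iio (1 : ℝ)).indicator (fun _ => min (ENNReal.ofReal t) (halfLine E)) s := by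
    intro s hs
    rw [mem_Ioi] at hs
    by_cases h : s < 1
    · have : {x | s < |E.indicator (fun _ => (1 : ℝ)) x|} = E := by
        ext x
        by_cases hx : x ∈ E <;> simp [hx, h, hs.le]
      rw [distrib, this, indicator_of_mem (mem_Iio.2 h)]
    · have : {x | s < |E.indicator (fun _ => (1 : ℝ)) x|} = ∅ := by
        ext x
        by_cases hx : x ∈ E <;> simp [hx, not_lt.1 h, hs.le]
      rw [distrib, this, indicator_of_notMem (by simpa using h), measure_empty, min_zero]
  rw [setLIntegral_congr_fun measurableSet_Ioi h1, lintegral_indicator measurableSet_Iio,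
    Measure.restrict_restrict measurableSet_Iio, lintegral_const, Measure.restrict_apply_univ,
    inter_comm, Ioi_inter_Iio, Real.volume_Ioo]
  simp

lemma setLIntegral_le_mul_maxRearr {f : ℝ → ℝ} (hf : AEMeasurable f halfLine) {E : Set ℝ}
    {a : ℝ} (ha : 0 < a) (hE : halfLine E ≤ ENNReal.ofReal a) :
    ∫⁻ x in E, ENNReal.ofReal (f x) ∂halfLine ≤ ENNReal.ofReal a * maxRearr f a := by
  rw [← lintegral_rearr_eq_mul f ha, lintegral_rearr]
  refine (lintegral_mono fun x => ENNReal.ofReal_le_ofReal (le_abs_self (f x))).trans ?_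
  rw [lintegral_eq_lintegral_meas_lt (halfLine.restrict E)
    (Eventually.of_forall fun x => abs_nonneg (f x)) hf.abs.restrict]
  refine lintegral_mono fun s => le_min ?_ ?_
  · refine (measure_mono (subset_univ _)).trans ?_
    rwa [Measure.restrict_apply_univ]
  · exact Measure.restrict_apply_le _ _

lemma tendsto_distrib {fn : ℕ → ℝ → ℝ} {f : ℝ → ℝ}
    (h : ∀ᵐ x ∂halfLine, (∀ n, 0 ≤ fn n x) ∧ Monotone (fun n => fn n x) ∧
      Tendsto (fun n => fn n x) atTop (𝓝 (f x))) (s : ℝ) :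
    Tendsto (fun n => distrib (fn n) s) atTop (𝓝 (distrib f s)) := by
  let G : Set ℝ := {x | (∀ n, 0 ≤ fn n x) ∧ Monotone (fun n => fn n x) ∧
      Tendsto (fun n => fn n x) atTop (𝓝 (f x))}
  have hG : G ∈ ae halfLine := h
  have key : ∀ S : Set ℝ, halfLine (S ∩ G) = halfLine S := fun S =>
    measure_congr (inter_ae_eq_left_of_ae_eq_univ (eventuallyEq_univ.2 hG))
  have hmono : Monotone fun n => {x | s < |fn n x|} ∩ G := by
    rintro m n hmn x ⟨hx, hxG⟩
    refine ⟨lt_of_lt_of_le (b := |fn m x|) hx ?_, hxG⟩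
    rw [abs_of_nonneg (hxG.1 m), abs_of_nonneg (hxG.1 n)]
    exact hxG.2.1 hmn
  have hU : {x | s < |f x|} ∩ G = ⋃ n, {x | s < |fn n x|} ∩ G := by
    ext x
    simp only [mem_inter_iff, mem_iUnion, mem_ofPred_eq, exists_and_right]
    refine and_congr_left fun hxG => ⟨fun hx => ?_, ?_⟩
    · exact (hxG.2.2.abs.eventually (lt_mem_nhds hx)).exists
    · rintro ⟨n, hn⟩
      refine hn.trans_le ?_
      have hle := hxG.2.1.ge_of_tendsto hxG.2.2 n
      rwa [abs_of_nonneg (hxG.1 n), abs_of_nonneg ((hxG.1 n).trans hle)]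
  have := tendsto_measure_iUnion_atTop (μ := halfLine) hmono
  rw [← hU] at this
  simpa only [distrib, Function.comp_def, key] using this

lemma monotone_maxRearr {fn : ℕ → ℝ → ℝ}
    (h : ∀ᵐ x ∂halfLine, (∀ n, 0 ≤ fn n x) ∧ Monotone (fun n => fn n x)) (t : ℝ) :
    Monotone fun n => maxRearr (fn n) t := fun m n hmn =>
  maxRearr_mono (h.mono fun x hx => by
    rw [abs_of_nonneg (hx.1 m), abs_of_nonneg (hx.1 n)]
    exact hx.2 hmn) t

lemma tendsto_maxRearr {fn : ℕ → ℝ → ℝ} {f : ℝ → ℝ}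
    (h : ∀ᵐ x ∂halfLine, (∀ n, 0 ≤ fn n x) ∧ Monotone (fun n => fn n x) ∧
      Tendsto (fun n => fn n x) atTop (𝓝 (f x))) (t : ℝ) :
    Tendsto (fun n => maxRearr (fn n) t) atTop (𝓝 (maxRearr f t)) := by
  rcases le_or_gt t 0 with ht | ht
  · simp [maxRearr_of_nonpos _ ht]
  simp only [maxRearr_eq]
  refine ENNReal.Tendsto.const_mul ?_ (Or.inr (ENNReal.inv_ne_top.2 (by simpa using ht)))
  refine lintegral_tendsto_of_tendsto_of_monotone
    (fun n => (measurable_const.min (distrib_antitone _).measurable).aemeasurable)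
    (Eventually.of_forall fun s m n hmn => ?_)
    (Eventually.of_forall fun s => tendsto_const_nhds.min (tendsto_distrib h s))
  refine min_le_min le_rfl (distrib_mono (h.mono fun x hx => ?_) s)
  rw [abs_of_nonneg (hx.1 m), abs_of_nonneg (hx.1 n)]
  exact hx.2.1 hmn

/-! ### The norm of the maximal function in `L^q(μ)` -/

/-- The `L^q(μ)` norm of `f^{**}`. The norms `gammaNorm` and `lorentzMaxNorm` are the cases in which
`μ` has the density `w(t)` or `t^{q/p-1}` on `(0,∞)`. -/
def maxNorm (q : ℝ) (μ : Measure ℝ) (f : ℝ → ℝ) : ℝ≥0∞ :=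
  (∫⁻ t, maxRearr f t ^ q ∂μ) ^ (1 / q)

/-- The characteristic function of `[0, a]`. -/
def unitStep (a : ℝ) : ℝ → ℝ := (Icc 0 a).indicator fun _ => 1

section maxNorm

variable {q : ℝ} {μ : Measure ℝ}

lemma maxNorm_le_of_forall (hq : 0 < q) {f g : ℝ → ℝ} (h : ∀ t, maxRearr g t ≤ maxRearr f t) :
    maxNorm q μ g ≤ maxNorm q μ f := by
  unfold maxNorm
  gcongr with t
  exact h t

lemma maxNorm_mono (hq : 0 < q) {f g : ℝ → ℝ} (h : ∀ᵐ x ∂halfLine, |g x| ≤ |f x|) :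
    maxNorm q μ g ≤ maxNorm q μ f :=
  maxNorm_le_of_forall hq (maxRearr_mono h)

lemma maxNorm_zero (hq : 0 < q) : maxNorm q μ 0 = 0 := by
  simp [maxNorm, maxRearr_zero, hq]

lemma maxNorm_add_le (hq : 1 ≤ q) {f g : ℝ → ℝ} (hf : AEMeasurable f halfLine)
    (hg : AEMeasurable g halfLine) : maxNorm q μ (f + g) ≤ maxNorm q μ f + maxNorm q μ g := by
  refine le_trans ?_ (ENNReal.lintegral_Lp_add_le (measurable_maxRearr f).aemeasurable
    (measurable_maxRearr g).aemeasurable hq)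
  unfold maxNorm
  gcongr with t
  exact maxRearr_add_le hf hg t

lemma const_mul_rpow_lintegral (hq : 0 < q) {c : ℝ≥0∞} {F : ℝ → ℝ≥0∞} (hF : Measurable F) :
    (∫⁻ t, (c * F t) ^ q ∂μ) ^ (1 / q) = c * (∫⁻ t, F t ^ q ∂μ) ^ (1 / q) := by
  simp only [ENNReal.mul_rpow_of_nonneg _ _ hq.le]
  rw [lintegral_const_mul _ (hF.pow_const q), ENNReal.mul_rpow_of_nonneg _ _ (by positivity),
    ← ENNReal.rpow_mul, mul_one_div_cancel hq.ne', ENNReal.rpow_one]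

lemma maxNorm_smul (hq : 0 < q) (a : ℝ) (f : ℝ → ℝ) :
    maxNorm q μ (a • f) = ENNReal.ofReal |a| * maxNorm q μ f := by
  simp only [maxNorm, maxRearr_smul]
  exact const_mul_rpow_lintegral hq (measurable_maxRearr f)

lemma tendsto_maxNorm (hq : 0 < q) {fn : ℕ → ℝ → ℝ} {f : ℝ → ℝ}
    (h : ∀ᵐ x ∂halfLine, (∀ n, 0 ≤ fn n x) ∧ Monotone (fun n => fn n x) ∧
      Tendsto (fun n => fn n x) atTop (𝓝 (f x))) :
    Tendsto (fun n => maxNorm q μ (fn n)) atTop (𝓝 (maxNorm q μ f)) := by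
  refine (ENNReal.continuous_rpow_const.tendsto _).comp ?_
  refine lintegral_tendsto_of_tendsto_of_monotone
    (fun n => ((measurable_maxRearr _).pow_const q).aemeasurable)
    (Eventually.of_forall fun t m n hmn => ?_)
    (Eventually.of_forall fun t =>
      (ENNReal.continuous_rpow_const.tendsto _).comp (tendsto_maxRearr h t))
  exact ENNReal.rpow_le_rpow
    (monotone_maxRearr (h.mono fun x hx => ⟨hx.1, hx.2.1⟩) t hmn) hq.le

lemma halfLine_Icc (a : ℝ) : halfLine (Icc 0 a) = ENNReal.ofReal a := by
  rw [halfLine, Measure.restrict_apply measurableSet_Icc,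
    inter_eq_left.2 (Icc_subset_Ici_self), Real.volume_Icc, sub_zero]

lemma aemeasurable_unitStep (a : ℝ) : AEMeasurable (unitStep a) halfLine :=
  (measurable_const.indicator measurableSet_Icc).aemeasurable

lemma maxRearr_unitStep_of_le {a t : ℝ} (ht : 0 < t) (h : t ≤ a) :
    maxRearr (unitStep a) t = 1 := by
  rw [unitStep, maxRearr_indicator, halfLine_Icc, min_eq_left (ENNReal.ofReal_le_ofReal h),
    ENNReal.inv_mul_cancel (by simpa using ht) ENNReal.ofReal_ne_top]

lemma maxRearr_unitStep_of_ge {a t : ℝ} (ht : 0 < t) (h : a ≤ t) :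
    maxRearr (unitStep a) t = ENNReal.ofReal (a / t) := by
  rw [unitStep, maxRearr_indicator, halfLine_Icc, min_eq_right (ENNReal.ofReal_le_ofReal h),
    ENNReal.ofReal_div_of_pos ht, ENNReal.div_eq_inv_mul]

lemma maxRearr_mul_unitStep_le (f : ℝ → ℝ) {a : ℝ} (ha : 0 < a) (t : ℝ) :
    maxRearr f a * maxRearr (unitStep a) t ≤ maxRearr f t := by
  rcases le_or_gt t 0 with ht | ht
  · simp [maxRearr_of_nonpos _ ht]
  rcases le_total t a with h | h
  · rw [maxRearr_unitStep_of_le ht h, mul_one]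
    exact maxRearr_antitoneOn f ht ha h
  · rw [maxRearr_unitStep_of_ge ht h, mul_comm]
    exact mul_maxRearr_le f ha h

lemma maxRearr_mul_maxNorm_unitStep_le (hq : 0 < q) (f : ℝ → ℝ) {a : ℝ} (ha : 0 < a) :
    maxRearr f a * maxNorm q μ (unitStep a) ≤ maxNorm q μ f := by
  unfold maxNorm
  rw [← const_mul_rpow_lintegral hq (measurable_maxRearr _)]
  gcongr with t
  exact maxRearr_mul_unitStep_le f ha t

lemma exists_maxRearr_le (hq : 0 < q) {a : ℝ} (ha : 0 < a) (h : maxNorm q μ (unitStep a) ≠ 0) :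
    ∃ K : ℝ≥0, 0 < K ∧ ∀ f, maxRearr f a ≤ K * maxNorm q μ f := by
  obtain ⟨c, hc, hlt⟩ := ENNReal.lt_iff_exists_nnreal_btwn.1 (pos_iff_ne_zero.2 h)
  have hc0 : c ≠ 0 := by
    rintro rfl
    simp at hc
  refine ⟨c⁻¹, by positivity, fun f => ?_⟩
  have h1 : maxRearr f a * c ≤ maxNorm q μ f :=
    (mul_le_mul_right hlt.le _).trans (maxRearr_mul_maxNorm_unitStep_le hq f ha)
  rw [ENNReal.coe_inv hc0, mul_comm, ← div_eq_mul_inv]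
  exact (ENNReal.le_div_iff_mul_le (Or.inl (by simpa using hc0)) (Or.inl (by simp))).2 h1

lemma exists_halfLine_le {E : Set ℝ} (hE : halfLine E < ∞) :
    ∃ a : ℝ, 0 < a ∧ halfLine E ≤ ENNReal.ofReal a := by
  refine ⟨(halfLine E).toReal + 1, by positivity, ?_⟩
  rw [ENNReal.ofReal_add ENNReal.toReal_nonneg zero_le_one, ENNReal.ofReal_toReal hE.ne]
  exact le_self_add

lemma isRINorm_maxNorm (hq : 1 ≤ q) (h0 : ∀ a, 0 < a → maxNorm q μ (unitStep a) ≠ 0)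
    (h1 : ∀ a, 0 < a → maxNorm q μ (unitStep a) ≠ ∞) : IsRINorm (maxNorm q μ) := by
  have hq0 : 0 < q := zero_lt_one.trans_le hq
  refine ⟨fun f g hf hg => maxNorm_add_le hq hf hg, fun a f _ => maxNorm_smul hq0 a f, ?_, ?_,
    ?_, ?_, ?_, ?_⟩
  · refine fun f _ => ⟨fun h => ?_, fun h => ?_⟩
    · obtain ⟨K, -, hK⟩ := exists_maxRearr_le hq0 one_pos (h0 1 one_pos)
      have := hK f
      rw [h, mul_zero, nonpos_iff_eq_zero] at this
      exact ae_eq_zero_of_maxRearr_eq_zero one_pos this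
    · refine le_antisymm ?_ zero_le
      rw [← maxNorm_zero (μ := μ) hq0]
      exact maxNorm_mono hq0 (h.mono fun x hx => by rw [hx])
  · refine fun f g _ _ h => maxNorm_mono hq0 (h.mono fun x hx => ?_)
    rw [abs_of_nonneg hx.1, abs_of_nonneg (hx.1.trans hx.2)]
    exact hx.2
  · refine fun fn f _ _ h => ⟨fun m n hmn => maxNorm_le_of_forall hq0 fun t => ?_,
      tendsto_maxNorm hq0 h⟩
    exact monotone_maxRearr (h.mono fun x hx => ⟨hx.1, hx.2.1⟩) t hmn
  · intro E _ hE
    obtain ⟨a, ha, hEa⟩ := exists_halfLine_le hE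
    refine lt_of_le_of_lt (maxNorm_le_of_forall hq0 fun t => ?_) (h1 a ha).lt_top
    rw [unitStep, maxRearr_indicator, maxRearr_indicator, halfLine_Icc]
    gcongr
  · intro E _ hE
    obtain ⟨a, ha, hEa⟩ := exists_halfLine_le hE
    obtain ⟨K, hK0, hK⟩ := exists_maxRearr_le hq0 ha (h0 a ha)
    refine ⟨a.toNNReal * K, mul_pos (Real.toNNReal_pos.2 ha) hK0, fun f hf _ => ?_⟩
    refine (setLIntegral_le_mul_maxRearr hf ha hEa).trans ?_
    rw [ENNReal.coe_mul, mul_assoc]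
    exact mul_le_mul_right (hK f) _
  · intro f g _ _ h
    have : ∀ t, maxRearr f t = maxRearr g t := fun t => by
      rw [maxRearr, maxRearr, setLIntegral_congr_fun measurableSet_Ioc fun s hs => h s hs.1]
    simp only [maxNorm, this]

lemma maxNorm_sum_le (hq : 1 ≤ q) {h : ℕ → ℝ → ℝ} (hm : ∀ n, AEMeasurable (h n) halfLine)
    (N : ℕ) : maxNorm q μ (∑ n ∈ Finset.range N, h n)
      ≤ ∑ n ∈ Finset.range N, maxNorm q μ (h n) := by
  induction N with
  | zero => simp [maxNorm_zero (zero_lt_one.trans_le hq)]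
  | succ N ih =>
    rw [Finset.sum_range_succ, Finset.sum_range_succ]
    refine (maxNorm_add_le hq (Finset.aemeasurable_sum _ fun n _ => hm n) (hm N)).trans ?_
    gcongr

/-! ### Automatic boundedness of inclusions -/

/-- The Riesz–Fischer property: a series of nonnegative functions with summable norms converges
a.e. to a function of finite norm. -/
lemma exists_sum_of_summable (hq : 1 ≤ q) (hμ : ∀ a, 0 < a → maxNorm q μ (unitStep a) ≠ 0)
    {h : ℕ → ℝ → ℝ} (hm : ∀ n, AEMeasurable (h n) halfLine) (h0 : ∀ n x, 0 ≤ h n x)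
    (hs : ∑' n, maxNorm q μ (h n) ≠ ∞) :
    ∃ g, AEMeasurable g halfLine ∧ maxNorm q μ g < ∞ ∧
      ∀ n, ∀ᵐ x ∂halfLine, h n x ≤ g x := by
  have hq0 : 0 < q := zero_lt_one.trans_le hq
  let H : ℝ → ℝ≥0∞ := fun x => ∑' n, ENNReal.ofReal (h n x)
  have hHm : AEMeasurable H halfLine := AEMeasurable.tsum fun n => (hm n).ennreal_ofReal
  -- `f^{**}(a)` is controlled by the norm of `f`, so the sum is integrable over bounded intervals.
  have hloc : ∀ k : ℕ, ∀ᵐ x ∂halfLine.restrict (Icc 0 ((k : ℝ) + 1)), H x < ∞ := by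
    intro k
    have hk : (0 : ℝ) < (k : ℝ) + 1 := by positivity
    obtain ⟨K, -, hK⟩ := exists_maxRearr_le hq0 hk (hμ _ hk)
    refine ae_lt_top' hHm.restrict ?_
    rw [lintegral_tsum fun n => (hm n).ennreal_ofReal.restrict]
    refine ne_top_of_le_ne_top ?_ (ENNReal.tsum_le_tsum fun n =>
      (setLIntegral_le_mul_maxRearr (hm n) hk (halfLine_Icc _).le).trans
        (mul_le_mul_right (hK (h n)) _))
    rw [ENNReal.tsum_mul_left, ENNReal.tsum_mul_left]
    exact ENNReal.mul_ne_top ENNReal.ofReal_ne_top (ENNReal.mul_ne_top ENNReal.coe_ne_top hs)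
  have hfin : ∀ᵐ x ∂halfLine, H x < ∞ := by
    have h2 : ∀ᵐ x ∂halfLine, ∀ k : ℕ, x ∈ Icc 0 ((k : ℝ) + 1) → H x < ∞ :=
      ae_all_iff.2 fun k => (ae_restrict_iff' measurableSet_Icc).1 (hloc k)
    have h3 : ∀ᵐ x ∂halfLine, x ∈ Ici (0 : ℝ) := ae_restrict_mem measurableSet_Ici
    filter_upwards [h2, h3] with x hx hx0
    exact hx ⌈x⌉₊ ⟨hx0, (Nat.le_ceil x).trans (by linarith)⟩
  have hsum : ∀ᵐ x ∂halfLine, HasSum (fun n => h n x) (H x).toReal := by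
    filter_upwards [hfin] with x hx
    have := ENNReal.hasSum_toReal hx.ne
    simp only [ENNReal.toReal_ofReal (h0 _ x)] at this
    rwa [ENNReal.tsum_toReal_eq fun n => ENNReal.ofReal_ne_top, tsum_congr fun n =>
      ENNReal.toReal_ofReal (h0 n x)]
  refine ⟨fun x => (H x).toReal, hHm.ennreal_toReal, ?_, fun n => ?_⟩
  · have ht := tendsto_maxNorm (q := q) (μ := μ) hq0
      (fn := fun N => ∑ n ∈ Finset.range N, h n) (f := fun x => (H x).toReal) <| by
      filter_upwards [hsum] with x hx
      simp only [Finset.sum_apply]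
      exact ⟨fun N => Finset.sum_nonneg fun n _ => h0 n x,
        fun M N hMN => Finset.sum_le_sum_of_subset_of_nonneg
          (Finset.range_subset_range.2 hMN) fun n _ _ => h0 n x, hx.tendsto_sum_nat⟩
    exact (le_of_tendsto' ht fun N => (maxNorm_sum_le hq hm N).trans
      (ENNReal.sum_le_tsum _)).trans_lt hs.lt_top
  · filter_upwards [hsum] with x hx
    exact le_hasSum hx n fun m _ => h0 m x

/-- An inclusion between the function spaces is automatically bounded, because a series of
functions violating all bounds would converge in the smaller space and not in the larger one. -/
lemma exists_maxNorm_le_of_subset (hq : 1 ≤ q) {ν : Measure ℝ}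
    (hμ : ∀ a, 0 < a → maxNorm q μ (unitStep a) ≠ 0)
    (h : ∀ f, AEMeasurable f halfLine → maxNorm q μ f < ∞ → maxNorm q ν f < ∞) :
    ∃ C : ℝ≥0, 0 < C ∧ ∀ f, AEMeasurable f halfLine → maxNorm q ν f ≤ C * maxNorm q μ f := by
  have hq0 : 0 < q := zero_lt_one.trans_le hq
  by_contra! H
  -- After division by `2^n` times the `μ`-norm of `f n`, the `μ`-norms are `2^{-n}` and the
  -- `ν`-norms at least `2^n`.
  choose f hf hlt using fun n : ℕ => H (4 ^ n) (by positivity)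
  have htop : ∀ n, maxNorm q μ (f n) ≠ ∞ := fun n hn => by
    have := hlt n
    rw [hn, ENNReal.mul_top (by simp)] at this
    exact not_top_lt this
  have hzero : ∀ n, maxNorm q μ (f n) ≠ 0 := fun n hn => by
    obtain ⟨K, -, hK⟩ := exists_maxRearr_le hq0 one_pos (hμ 1 one_pos)
    have h1 := hK (f n)
    rw [hn, mul_zero, nonpos_iff_eq_zero] at h1
    have h2 : maxNorm q ν (f n) ≤ maxNorm q ν 0 :=
      maxNorm_mono hq0 ((ae_eq_zero_of_maxRearr_eq_zero one_pos h1).mono fun x hx => by rw [hx])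
    rw [maxNorm_zero hq0] at h2
    exact not_lt_zero ((hlt n).trans_le h2)
  let c : ℕ → ℝ := fun n => (maxNorm q μ (f n)).toReal
  have hc : ∀ n, 0 < c n := fun n => ENNReal.toReal_pos (hzero n) (htop n)
  let g : ℕ → ℝ → ℝ := fun n => (2 ^ n * c n)⁻¹ • fun x => |f n x|
  have hnorm : ∀ (ρ : Measure ℝ) n,
      maxNorm q ρ (g n) = ((2 : ℝ≥0∞) ^ n)⁻¹ * ((maxNorm q μ (f n))⁻¹ * maxNorm q ρ (f n)) := by
    intro ρ n
    have habs : maxNorm q ρ (fun x => |f n x|) = maxNorm q ρ (f n) := by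
      simp only [maxNorm]
      simp only [maxRearr_congr (f := f n) (g := fun x => |f n x|)
        (Eventually.of_forall fun x => abs_abs _)]
    rw [maxNorm_smul hq0, habs, abs_of_pos (inv_pos.2 (mul_pos (by positivity) (hc n))),
      ENNReal.ofReal_inv_of_pos (mul_pos (by positivity) (hc n)),
      ENNReal.ofReal_mul (by positivity), ENNReal.ofReal_toReal (htop n),
      ENNReal.mul_inv (Or.inr (htop n)) (Or.inr (hzero n)), ENNReal.ofReal_pow zero_le_two,
      ENNReal.ofReal_ofNat, mul_assoc]
  have hgμ : ∀ n, maxNorm q μ (g n) = (2⁻¹ : ℝ≥0∞) ^ n := fun n => by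
    rw [hnorm, ENNReal.inv_mul_cancel (hzero n) (htop n), mul_one, ENNReal.inv_pow]
  have hgν : ∀ n, (2 : ℝ≥0∞) ^ n ≤ maxNorm q ν (g n) := fun n => by
    rw [hnorm]
    have h4 : (2 : ℝ≥0∞) ^ n = (2 ^ n)⁻¹ * ((maxNorm q μ (f n))⁻¹ *
        (((4 ^ n : ℝ≥0) : ℝ≥0∞) * maxNorm q μ (f n))) := by
      rw [mul_comm _ (maxNorm q μ (f n)), ← mul_assoc (maxNorm q μ (f n))⁻¹,
        ENNReal.inv_mul_cancel (hzero n) (htop n), one_mul]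
      have : ((4 ^ n : ℝ≥0) : ℝ≥0∞) = 2 ^ n * 2 ^ n := by
        rw [← mul_pow]; norm_num
      rw [this, ← mul_assoc, ENNReal.inv_mul_cancel (by simp) (by simp), one_mul]
    refine h4.le.trans ?_
    gcongr
    exact (hlt n).le
  obtain ⟨G, hGm, hGfin, hG⟩ := exists_sum_of_summable (q := q) (μ := μ) hq hμ (h := g)
    (fun n => (hf n).abs.const_smul _)
    (fun n x => mul_nonneg (inv_nonneg.2 (mul_nonneg (by positivity) (hc n).le)) (abs_nonneg _))
    (by simp [hgμ, ENNReal.tsum_geometric])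
  have hGν := h G hGm hGfin
  obtain ⟨n, hn⟩ := ENNReal.exists_nat_gt hGν.ne
  refine not_lt_of_ge ?_ hn
  calc maxNorm q ν G ≥ maxNorm q ν (g n) := maxNorm_mono hq0 <| (hG n).mono fun x hx => by
        have h1 : 0 ≤ g n x :=
          mul_nonneg (inv_nonneg.2 (mul_nonneg (by positivity) (hc n).le)) (abs_nonneg _)
        rwa [abs_of_nonneg h1, abs_of_nonneg (h1.trans hx)]
    _ ≥ 2 ^ n := hgν n
    _ ≥ n := by exact_mod_cast Nat.lt_two_pow_self.le

end maxNorm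

/-! ### Weights and homogeneity -/

/-- The measure `w(t) dt` on `(0, ∞)`. -/
def weightMeasure (w : ℝ → ℝ) : Measure ℝ :=
  (volume.restrict (Ioi 0)).withDensity fun t => ENNReal.ofReal (w t)

instance sFinite_weightMeasure (w : ℝ → ℝ) : SFinite (weightMeasure w) := by
  unfold weightMeasure
  infer_instance

/-- The measure `t^{q/p-1} dt` on `(0, ∞)` that defines the Lorentz norms. -/
def powerMeasure (p q : ℝ) : Measure ℝ := weightMeasure fun t => t ^ (q / p - 1)

lemma ae_weightMeasure_pos (w : ℝ → ℝ) : ∀ᵐ t ∂weightMeasure w, 0 < t :=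
  (withDensity_absolutelyContinuous _ _).ae_le (ae_restrict_mem measurableSet_Ioi)

lemma lintegral_weightMeasure {w : ℝ → ℝ} (hw : AEMeasurable w (volume.restrict (Ioi 0)))
    {F : ℝ → ℝ≥0∞} (hF : Measurable F) :
    ∫⁻ t, F t ∂weightMeasure w = ∫⁻ t in Ioi (0 : ℝ), F t * ENNReal.ofReal (w t) := by
  rw [weightMeasure, lintegral_withDensity_eq_lintegral_mul₀ hw.ennreal_ofReal hF.aemeasurable]
  simp only [Pi.mul_apply, mul_comm]

lemma lintegral_powerMeasure (p q : ℝ) {F : ℝ → ℝ≥0∞} (hF : Measurable F) :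
    ∫⁻ t, F t ∂powerMeasure p q
      = ∫⁻ t in Ioi (0 : ℝ), F t * ENNReal.ofReal (t ^ (q / p - 1)) :=
  lintegral_weightMeasure (measurable_id.pow_const _).aemeasurable hF

lemma IsWeight.aemeasurable {w : ℝ → ℝ} (hw : IsWeight w) :
    AEMeasurable w (volume.restrict (Ioi 0)) :=
  (hw.locallyIntegrable.aestronglyMeasurable.aemeasurable).mono_measure
    (Measure.restrict_mono Ioi_subset_Ici_self le_rfl)

lemma gammaNorm_eq {q : ℝ} {w : ℝ → ℝ} (hw : IsWeight w) :
    gammaNorm q w = maxNorm q (weightMeasure w) := by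
  funext f
  rw [gammaNorm, maxNorm, lintegral_weightMeasure hw.aemeasurable
    ((measurable_maxRearr f).pow_const q)]

lemma lorentzMaxNorm_eq (p q : ℝ) : lorentzMaxNorm p q = maxNorm q (powerMeasure p q) := by
  funext f
  rw [lorentzMaxNorm, maxNorm, lintegral_powerMeasure p q ((measurable_maxRearr f).pow_const q)]

lemma lorentzNorm_eq (p q : ℝ) (f : ℝ → ℝ) :
    lorentzNorm p q f = (∫⁻ t, rearr f t ^ q ∂powerMeasure p q) ^ (1 / q) := by
  rw [lorentzNorm, lintegral_powerMeasure p q ((measurable_rearr f).pow_const q)]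

lemma maxNorm_unitStep_ne_zero {q : ℝ} (hq : 0 < q) {w : ℝ → ℝ} (hw : weightMeasure w ≠ 0)
    {a : ℝ} (ha : 0 < a) : maxNorm q (weightMeasure w) (unitStep a) ≠ 0 := by
  intro h
  rw [maxNorm, ENNReal.rpow_eq_zero_iff_of_pos (by positivity),
    lintegral_eq_zero_iff ((measurable_maxRearr _).pow_const q)] at h
  refine hw (ae_eq_bot.1 (eventually_false_iff_eq_bot.1 ?_))
  filter_upwards [h, ae_weightMeasure_pos w] with t ht ht0
  rw [Pi.zero_apply, ENNReal.rpow_eq_zero_iff_of_pos hq] at ht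
  rcases le_total t a with hta | hta
  · simp [maxRearr_unitStep_of_le ht0 hta] at ht
  · rw [maxRearr_unitStep_of_ge ht0 hta, ENNReal.ofReal_eq_zero] at ht
    exact not_lt.2 ht (div_pos ha ht0)

lemma powerMeasure_ne_zero (p q : ℝ) : powerMeasure p q ≠ 0 := by
  intro h
  have h1 := lintegral_powerMeasure p q (F := fun _ => 1) measurable_const
  simp only [one_mul] at h1
  rw [h, lintegral_zero_measure, eq_comm, lintegral_eq_zero_iff
    (f := fun t : ℝ => ENNReal.ofReal (t ^ (q / p - 1)))
    (measurable_id.pow_const _).ennreal_ofReal] at h1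
  have h2 : (volume.restrict (Ioi (0 : ℝ))) = 0 := by
    refine ae_eq_bot.1 (eventually_false_iff_eq_bot.1 ?_)
    filter_upwards [h1, ae_restrict_mem measurableSet_Ioi] with t ht ht0
    rw [Pi.zero_apply, ENNReal.ofReal_eq_zero] at ht
    exact not_lt.2 ht (Real.rpow_pos_of_pos ht0 _)
  simp at h2

/-- Scaling of the `L^q` norm with respect to `t^{q/p-1} dt`. -/
lemma powerNorm_comp_mul {p q : ℝ} (hq : 0 < q) {F : ℝ → ℝ≥0∞} (hF : Measurable F) {r : ℝ}
    (hr : 0 < r) :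
    (∫⁻ t, F (r * t) ^ q ∂powerMeasure p q) ^ (1 / q)
      = ENNReal.ofReal (r ^ (-1 / p)) * (∫⁻ t, F t ^ q ∂powerMeasure p q) ^ (1 / q) := by
  have h1 : ∀ t ∈ Ioi (0 : ℝ), F (r * t) ^ q * ENNReal.ofReal (t ^ (q / p - 1))
      = ENNReal.ofReal (r ^ (1 - q / p)) *
        (F (r * t) ^ q * ENNReal.ofReal ((r * t) ^ (q / p - 1))) := by
    intro t ht
    rw [mul_left_comm, ← ENNReal.ofReal_mul (Real.rpow_nonneg hr.le _),
      Real.mul_rpow hr.le (mem_Ioi.1 ht).le, ← mul_assoc, ← Real.rpow_add hr]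
    simp
  rw [lintegral_powerMeasure p q (F := fun t => F (r * t) ^ q)
      ((hF.comp (measurable_const_mul r)).pow_const q),
    lintegral_powerMeasure p q (hF.pow_const q),
    setLIntegral_congr_fun measurableSet_Ioi h1, lintegral_const_mul' _ _ ENNReal.ofReal_ne_top,
    lintegral_Ioi_comp_mul (F := fun t => F t ^ q * ENNReal.ofReal (t ^ (q / p - 1))) hr,
    ← mul_assoc, ← ENNReal.ofReal_mul (Real.rpow_nonneg hr.le _),
    ENNReal.mul_rpow_of_nonneg _ _ (by positivity)]
  congr 1
  rw [ENNReal.ofReal_rpow_of_nonneg (by positivity) (by positivity), ← Real.rpow_neg_one r,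
    ← Real.rpow_add hr, ← Real.rpow_mul hr.le]
  congr 2
  field_simp
  ring

lemma maxNorm_dilation {p q : ℝ} (hq : 0 < q) (f : ℝ → ℝ) {r : ℝ} (hr : 0 < r) :
    maxNorm q (powerMeasure p q) (dilation r f)
      = ENNReal.ofReal (r ^ (-1 / p)) * maxNorm q (powerMeasure p q) f := by
  simp only [maxNorm, maxRearr_dilation hr]
  exact powerNorm_comp_mul hq (measurable_maxRearr f) hr

lemma dilation_unitStep {a : ℝ} (ha : 0 < a) : dilation a⁻¹ (unitStep 1) = unitStep a := by
  funext x
  have : a⁻¹ * x ∈ Icc (0 : ℝ) 1 ↔ x ∈ Icc 0 a := by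
    rw [mem_Icc, mem_Icc, mul_nonneg_iff_of_pos_left (inv_pos.2 ha), inv_mul_le_iff₀ ha, mul_one]
  simp only [dilation, unitStep, indicator_apply, this]

lemma inv_rpow_neg_one_div {a : ℝ} (ha : 0 < a) (p : ℝ) : a⁻¹ ^ (-1 / p) = a ^ (1 / p) := by
  rw [Real.inv_rpow ha.le, ← Real.rpow_neg ha.le, neg_div, neg_neg]

lemma maxNorm_powerMeasure_unitStep {p q : ℝ} (hq : 0 < q) {a : ℝ} (ha : 0 < a) :
    maxNorm q (powerMeasure p q) (unitStep a)
      = ENNReal.ofReal (a ^ (1 / p)) * maxNorm q (powerMeasure p q) (unitStep 1) := by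
  rw [← dilation_unitStep ha, maxNorm_dilation hq _ (inv_pos.2 ha), inv_rpow_neg_one_div ha]

lemma maxNorm_powerMeasure_unitStep_ne_top {p q : ℝ} (hp : 1 < p) (hq : 0 < q) {a : ℝ}
    (ha : 0 < a) : maxNorm q (powerMeasure p q) (unitStep a) ≠ ∞ := by
  have hp0 : 0 < p := zero_lt_one.trans hp
  rw [maxNorm_powerMeasure_unitStep hq ha]
  refine ENNReal.mul_ne_top ENNReal.ofReal_ne_top (ENNReal.rpow_ne_top_of_nonneg (by positivity) ?_)
  rw [lintegral_powerMeasure p q ((measurable_maxRearr _).pow_const q),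
    ← Ioc_union_Ioi_eq_Ioi zero_le_one]
  refine ne_top_of_le_ne_top (ENNReal.add_ne_top.2 ⟨?_, ?_⟩) (lintegral_union_le _ _ _)
  · have h1 : ∀ t ∈ Ioc (0 : ℝ) 1,
        maxRearr (unitStep 1) t ^ q * ENNReal.ofReal (t ^ (q / p - 1))
          = ENNReal.ofReal (t ^ (q / p - 1)) := fun t ht => by
      rw [maxRearr_unitStep_of_le ht.1 ht.2, ENNReal.one_rpow, one_mul]
    rw [setLIntegral_congr_fun measurableSet_Ioc h1]
    have hi := (intervalIntegrable_iff_integrableOn_Ioc_of_le zero_le_one).1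
      (intervalIntegral.intervalIntegrable_rpow' (a := 0) (b := 1) (r := q / p - 1)
        (by have := div_pos hq hp0; linarith))
    exact (Integrable.lintegral_lt_top hi).ne
  · have h1 : ∀ t ∈ Ioi (1 : ℝ),
        maxRearr (unitStep 1) t ^ q * ENNReal.ofReal (t ^ (q / p - 1))
          = ENNReal.ofReal (t ^ (q / p - 1 - q)) := fun t ht => by
      have ht0 : 0 < t := zero_lt_one.trans ht
      rw [maxRearr_unitStep_of_ge ht0 (mem_Ioi.1 ht).le,
        ENNReal.ofReal_rpow_of_nonneg (by positivity) hq.le,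
        ← ENNReal.ofReal_mul (by positivity), Real.rpow_sub ht0 _ q, one_div,
        Real.inv_rpow ht0.le, mul_comm, ← div_eq_mul_inv]
    rw [setLIntegral_congr_fun measurableSet_Ioi h1]
    have hqp : q / p < q := div_lt_self hq hp
    exact (Integrable.lintegral_lt_top
      (integrableOn_Ioi_rpow_of_lt (by linarith : q / p - 1 - q < -1) one_pos)).ne

lemma isHomogeneousRINorm_maxNorm {p q : ℝ} (hp : 1 < p) (hq : 1 ≤ q) :
    IsHomogeneousRINorm p (maxNorm q (powerMeasure p q)) where
  isRINorm := isRINorm_maxNorm hq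
    (fun _ => maxNorm_unitStep_ne_zero (zero_lt_one.trans_le hq) (powerMeasure_ne_zero p q))
    (fun _ => maxNorm_powerMeasure_unitStep_ne_top hp (zero_lt_one.trans_le hq))
  homogeneous f _ _ _ hr := maxNorm_dilation (zero_lt_one.trans_le hq) f hr

/-! ### Hardy's inequality -/

/-- Minkowski's inequality for series. -/
lemma lintegral_Lp_tsum_le {q : ℝ} (hq : 1 ≤ q) {μ : Measure ℝ} {F : ℕ → ℝ → ℝ≥0∞}
    (hF : ∀ k, Measurable (F k)) :
    (∫⁻ t, (∑' k, F k t) ^ q ∂μ) ^ (1 / q) ≤ ∑' k, (∫⁻ t, F k t ^ q ∂μ) ^ (1 / q) := by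
  have hq0 : 0 < q := zero_lt_one.trans_le hq
  have hfin : ∀ N : ℕ, (∫⁻ t, (∑ k ∈ Finset.range N, F k t) ^ q ∂μ) ^ (1 / q)
      ≤ ∑ k ∈ Finset.range N, (∫⁻ t, F k t ^ q ∂μ) ^ (1 / q) := by
    intro N
    induction N with
    | zero => simp [hq0]
    | succ N ih =>
      simp only [Finset.sum_range_succ]
      refine (ENNReal.lintegral_Lp_add_le
        (Finset.measurable_sum _ fun k _ => hF k).aemeasurable (hF N).aemeasurable hq).trans ?_
      gcongr
  have ht : Tendsto (fun N => (∫⁻ t, (∑ k ∈ Finset.range N, F k t) ^ q ∂μ) ^ (1 / q)) atTop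
      (𝓝 ((∫⁻ t, (∑' k, F k t) ^ q ∂μ) ^ (1 / q))) := by
    refine (ENNReal.continuous_rpow_const.tendsto _).comp ?_
    refine lintegral_tendsto_of_tendsto_of_monotone
      (fun N => ((Finset.measurable_sum _ fun k _ => hF k).pow_const q).aemeasurable)
      (Eventually.of_forall fun t M N hMN => ?_)
      (Eventually.of_forall fun t => (ENNReal.continuous_rpow_const.tendsto _).comp
        (ENNReal.tendsto_nat_tsum _))
    exact ENNReal.rpow_le_rpow
      (Finset.sum_le_sum_of_subset (Finset.range_subset_range.2 hMN)) hq0.le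
  exact le_of_tendsto' ht fun N => (hfin N).trans (ENNReal.sum_le_tsum _)

/-- The dyadic pieces of `(0, t]`, on each of which `f^*` is at most its value at the left
endpoint. -/
lemma maxRearr_le_tsum (f : ℝ → ℝ) {t : ℝ} (ht : 0 < t) :
    maxRearr f t ≤ ∑' k : ℕ, ENNReal.ofReal ((1 / 2) ^ (k + 1)) *
      rearr f ((1 / 2) ^ (k + 1) * t) := by
  have hsub : Ioc 0 t ⊆ ⋃ k : ℕ, Ioc ((1 / 2) ^ (k + 1) * t) ((1 / 2) ^ k * t) := by
    intro x hx
    obtain ⟨k, h1, h2⟩ := exists_nat_pow_near_of_lt_one (div_pos hx.1 ht)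
      ((div_le_one ht).2 hx.2) (by norm_num : (0 : ℝ) < 1 / 2) (by norm_num)
    exact mem_iUnion.2 ⟨k, (lt_div_iff₀ ht).1 h1, (div_le_iff₀ ht).1 h2⟩
  have hint : ∫⁻ s in Ioc 0 t, rearr f s ≤ ∑' k : ℕ, ENNReal.ofReal t *
      (ENNReal.ofReal ((1 / 2) ^ (k + 1)) * rearr f ((1 / 2) ^ (k + 1) * t)) := by
    refine (lintegral_mono_set hsub).trans ((lintegral_iUnion_le _ _).trans ?_)
    refine ENNReal.tsum_le_tsum fun k => ?_
    refine (setLIntegral_mono' measurableSet_Ioc fun x hx =>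
      rearr_antitone f hx.1.le).trans ?_
    rw [setLIntegral_const, Real.volume_Ioc, mul_comm, ← mul_assoc, ← ENNReal.ofReal_mul ht.le]
    refine mul_le_mul_left (ENNReal.ofReal_le_ofReal (le_of_eq ?_)) _
    ring
  rw [ENNReal.tsum_mul_left] at hint
  have h0 : ENNReal.ofReal t ≠ 0 := by simpa using ht
  calc maxRearr f t ≤ (ENNReal.ofReal t)⁻¹ * (ENNReal.ofReal t * _) := by
        rw [maxRearr]
        exact mul_le_mul_right hint _
    _ = _ := by
        rw [← mul_assoc, ENNReal.inv_mul_cancel h0 ENNReal.ofReal_ne_top, one_mul]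

/-- Hardy's inequality. -/
lemma exists_lorentzMaxNorm_le {p q : ℝ} (hp : 1 < p) (hq : 1 ≤ q) :
    ∃ C : ℝ≥0, 0 < C ∧ ∀ f, lorentzMaxNorm p q f ≤ C * lorentzNorm p q f := by
  have hq0 : 0 < q := zero_lt_one.trans_le hq
  let θ : ℝ := (1 / 2) ^ (1 - 1 / p)
  have hθ0 : 0 ≤ θ := by positivity
  have hθ1 : θ < 1 := Real.rpow_lt_one (by norm_num) (by norm_num)
    (sub_pos.2 ((div_lt_one (zero_lt_one.trans hp)).2 hp))
  have key : ∀ f, lorentzMaxNorm p q f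
      ≤ (∑' k : ℕ, ENNReal.ofReal θ ^ (k + 1)) * lorentzNorm p q f := by
    intro f
    rw [lorentzMaxNorm_eq, lorentzNorm_eq, maxNorm]
    calc _ ≤ (∫⁻ t, (∑' k : ℕ, ENNReal.ofReal ((1 / 2) ^ (k + 1)) *
              rearr f ((1 / 2) ^ (k + 1) * t)) ^ q ∂powerMeasure p q) ^ (1 / q) := by
          refine ENNReal.rpow_le_rpow (lintegral_mono_ae ?_) (by positivity)
          filter_upwards [ae_weightMeasure_pos _] with t ht
          exact ENNReal.rpow_le_rpow (maxRearr_le_tsum f ht) hq0.le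
      _ ≤ ∑' k : ℕ, (∫⁻ t, (ENNReal.ofReal ((1 / 2) ^ (k + 1)) *
              rearr f ((1 / 2) ^ (k + 1) * t)) ^ q ∂powerMeasure p q) ^ (1 / q) :=
          lintegral_Lp_tsum_le hq fun k =>
            ((measurable_rearr f).comp (measurable_const_mul _)).const_mul _
      _ = _ := by
          rw [← ENNReal.tsum_mul_right]
          refine tsum_congr fun k => ?_
          have hb : (0 : ℝ) < (1 / 2) ^ (k + 1) := by positivity
          rw [const_mul_rpow_lintegral hq0
            (F := fun t => rearr f ((1 / 2) ^ (k + 1) * t))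
            ((measurable_rearr f).comp (measurable_const_mul _)),
            powerNorm_comp_mul hq0 (measurable_rearr f) hb, ← mul_assoc,
            ← ENNReal.ofReal_mul hb.le, ← ENNReal.ofReal_pow hθ0]
          congr 2
          calc ((1 / 2 : ℝ) ^ (k + 1)) * ((1 / 2) ^ (k + 1)) ^ (-1 / p)
              = ((1 / 2 : ℝ) ^ (k + 1)) ^ (1 + -1 / p) := by
                rw [Real.rpow_add hb, Real.rpow_one]
            _ = θ ^ (k + 1) := by
                rw [← Real.rpow_natCast, ← Real.rpow_natCast, ← Real.rpow_mul (by norm_num),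
                  ← Real.rpow_mul (by norm_num), mul_comm]
                congr 2
                ring
  have hfin : ∑' k : ℕ, ENNReal.ofReal θ ^ (k + 1) ≠ ∞ := by
    simp only [pow_succ]
    rw [ENNReal.tsum_mul_right, ENNReal.tsum_geometric]
    refine ENNReal.mul_ne_top (ENNReal.inv_ne_top.2 ?_) ENNReal.ofReal_ne_top
    exact (tsub_pos_of_lt (by rwa [ENNReal.ofReal_lt_one])).ne'
  refine ⟨(∑' k : ℕ, ENNReal.ofReal θ ^ (k + 1)).toNNReal + 1, by positivity, fun f =>
    (key f).trans ?_⟩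
  rw [ENNReal.coe_add, ENNReal.coe_toNNReal hfin]
  gcongr
  exact le_self_add

lemma lorentzNorm_le_lorentzMaxNorm {p q : ℝ} (hq : 0 < q) (f : ℝ → ℝ) :
    lorentzNorm p q f ≤ lorentzMaxNorm p q f := by
  rw [lorentzMaxNorm_eq, lorentzNorm_eq, maxNorm]
  refine ENNReal.rpow_le_rpow (lintegral_mono_ae ?_) (by positivity)
  filter_upwards [ae_weightMeasure_pos _] with t ht
  exact ENNReal.rpow_le_rpow (rearr_le_maxRearr f ht) hq.le

/-! ### Norms determined by characteristic functions -/

/-- `f^{**}` varies by at most the factor `M` over intervals of bounded logarithmic length. -/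
lemma maxRearr_le_mul (f : ℝ → ℝ) {s t M : ℝ} (hs : 0 < s) (ht : 0 < t) (hM : 1 ≤ M)
    (h : t ≤ M * s) : maxRearr f s ≤ ENNReal.ofReal M * maxRearr f t := by
  have hM0 : 0 < M := zero_lt_one.trans_le hM
  rcases le_total t s with hts | hts
  · calc maxRearr f s ≤ 1 * maxRearr f t := by
          rw [one_mul]; exact maxRearr_antitoneOn f ht hs hts
      _ ≤ _ := by
          gcongr
          rwa [ENNReal.one_le_ofReal]
  · calc maxRearr f s ≤ ENNReal.ofReal M * (ENNReal.ofReal (s / t) * maxRearr f s) := by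
          rw [← mul_assoc, ← ENNReal.ofReal_mul hM0.le]
          refine le_mul_of_one_le_left zero_le ?_
          rw [ENNReal.one_le_ofReal, ← mul_div_assoc, one_le_div ht]
          exact h
      _ ≤ _ := by
          gcongr
          exact mul_maxRearr_le f hs hts

lemma maxRearr_unitStep_le_one (a t : ℝ) : maxRearr (unitStep a) t ≤ 1 := by
  rcases le_or_gt t 0 with ht | ht
  · simp [maxRearr_of_nonpos _ ht]
  rcases le_total t a with h | h
  · exact (maxRearr_unitStep_of_le ht h).le
  · rw [maxRearr_unitStep_of_ge ht h]
    exact ENNReal.ofReal_le_one.2 ((div_le_one ht).2 h)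

lemma measure_le_lintegral_unitStep {q : ℝ} (μ : Measure ℝ) (a : ℝ) :
    μ (Ioc 0 a) ≤ ∫⁻ t, maxRearr (unitStep a) t ^ q ∂μ := by
  rw [← lintegral_indicator_one measurableSet_Ioc]
  refine lintegral_mono fun t => ?_
  by_cases ht : t ∈ Ioc 0 a
  · rw [indicator_of_mem ht, maxRearr_unitStep_of_le ht.1 ht.2, ENNReal.one_rpow]
    rfl
  · rw [indicator_of_notMem ht]
    exact zero_le

/-- `min(1, s/t)^q` is split according to `t ≤ s/M`, `s/M < t < sM` and `t ≥ sM`. -/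
lemma lintegral_unitStep_le {q : ℝ} (hq : 0 < q) (μ : Measure ℝ) {s M : ℝ} (hs : 0 < s)
    (hM : 0 < M) :
    ∫⁻ t, maxRearr (unitStep s) t ^ q ∂μ
      ≤ ∫⁻ t, maxRearr (unitStep (s / M)) t ^ q ∂μ + μ (Ioo (s / M) (s * M))
        + ENNReal.ofReal (M ^ (-q)) * ∫⁻ t, maxRearr (unitStep (s * M)) t ^ q ∂μ := by
  have hmeas : ∀ a, Measurable fun t => maxRearr (unitStep a) t ^ q := fun a =>
    (measurable_maxRearr _).pow_const q
  rw [← lintegral_indicator_one measurableSet_Ioo, ← lintegral_add_left (hmeas _),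
    ← lintegral_const_mul _ (hmeas _), ← lintegral_add_left (μ := μ)
      (f := fun t => maxRearr (unitStep (s / M)) t ^ q + (Ioo (s / M) (s * M)).indicator 1 t)
      ((hmeas _).add (measurable_one.indicator measurableSet_Ioo))]
  refine lintegral_mono fun t => ?_
  beta_reduce
  rcases le_or_gt t 0 with ht | ht
  · simp [maxRearr_of_nonpos _ ht, hq]
  have hle1 : maxRearr (unitStep s) t ^ q ≤ 1 := by
    have := ENNReal.rpow_le_rpow (maxRearr_unitStep_le_one s t) hq.le
    rwa [ENNReal.one_rpow] at this
  rcases le_or_gt t (s / M) with h1 | h1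
  · refine le_add_right (le_add_right ?_)
    rwa [maxRearr_unitStep_of_le ht h1, ENNReal.one_rpow]
  rcases lt_or_ge t (s * M) with h2 | h2
  · refine le_add_right (le_add_left ?_)
    rwa [indicator_of_mem (show t ∈ Ioo (s / M) (s * M) from ⟨h1, h2⟩), Pi.one_apply]
  · refine le_add_left ?_
    have h3 : maxRearr (unitStep s) t ≤ ENNReal.ofReal (s / t) := by
      rcases le_total t s with h | h
      · rw [maxRearr_unitStep_of_le ht h, ENNReal.one_le_ofReal]
        exact (one_le_div ht).2 h
      · rw [maxRearr_unitStep_of_ge ht h]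
    refine (ENNReal.rpow_le_rpow h3 hq.le).trans (le_of_eq ?_)
    rw [maxRearr_unitStep_of_ge ht h2, ENNReal.ofReal_rpow_of_nonneg (by positivity) hq.le,
      ENNReal.ofReal_rpow_of_nonneg (by positivity) hq.le, ← ENNReal.ofReal_mul (by positivity),
      mul_div_right_comm, Real.mul_rpow (by positivity) hM.le, mul_comm, mul_assoc,
      ← Real.rpow_add hM]
    simp

lemma measure_Ioo_le {q e C s M : ℝ} {μ : Measure ℝ} (hM : 0 < M)
    (hC : ∀ a, 0 < a → ∫⁻ t, maxRearr (unitStep a) t ^ q ∂μ ≤ ENNReal.ofReal (C * a ^ e))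
    (hs : 0 < s) : μ (Ioo (s / M) (s * M)) ≤ ENNReal.ofReal (C * M ^ e * s ^ e) := by
  refine (measure_mono fun t ht => ?_).trans ((measure_le_lintegral_unitStep (q := q) μ
    (s * M)).trans ((hC _ (mul_pos hs hM)).trans (le_of_eq ?_)))
  · exact ⟨(div_pos hs hM).trans ht.1, ht.2.le⟩
  · rw [Real.mul_rpow hs.le hM.le]
    congr 1
    ring

/-- If the norm of the characteristic function of `[0, a]` is of the order of a power of `a`
strictly between `0` and `1`, then `μ` charges every interval `(s/M, sM)` for large `M`, since the
contributions of its complement to the norm of the characteristic function of `[0, s]` are small. -/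
lemma exists_le_measure_Ioo {q e c C : ℝ} {μ : Measure ℝ} (hq : 0 < q) (he : 0 < e) (heq : e < q)
    (hc : 0 < c) (hC0 : 0 < C)
    (hcμ : ∀ a, 0 < a → ENNReal.ofReal (c * a ^ e) ≤ ∫⁻ t, maxRearr (unitStep a) t ^ q ∂μ)
    (hC : ∀ a, 0 < a → ∫⁻ t, maxRearr (unitStep a) t ^ q ∂μ ≤ ENNReal.ofReal (C * a ^ e)) :
    ∃ M : ℝ, 2 ≤ M ∧ ∀ s, 0 < s →
      ENNReal.ofReal (c / 2 * s ^ e) ≤ μ (Ioo (s / M) (s * M)) := by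
  have hlim : Tendsto (fun M : ℝ => C * (M ^ (-e) + M ^ (-(q - e)))) atTop (𝓝 (C * (0 + 0))) :=
    ((tendsto_rpow_neg_atTop he).add (tendsto_rpow_neg_atTop (sub_pos.2 heq))).const_mul C
  rw [add_zero, mul_zero] at hlim
  obtain ⟨M, hMc, hM⟩ := ((hlim.eventually (gt_mem_nhds (half_pos hc))).and
    (eventually_ge_atTop 2)).exists
  have hM0 : 0 < M := by linarith
  refine ⟨M, hM, fun s hs => ?_⟩
  -- The bound from below on the whole integral leaves `c s^e / 2` for the middle part.
  have hse : 0 < s ^ e := Real.rpow_pos_of_pos hs e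
  have h1 := (hcμ s hs).trans (lintegral_unitStep_le hq μ hs hM0)
  have h2 : ENNReal.ofReal (c * s ^ e)
      ≤ ENNReal.ofReal (c / 2 * s ^ e) + μ (Ioo (s / M) (s * M)) := by
    calc ENNReal.ofReal (c * s ^ e)
        ≤ ENNReal.ofReal (C * (s / M) ^ e) + μ (Ioo (s / M) (s * M))
          + ENNReal.ofReal (M ^ (-q)) * ENNReal.ofReal (C * (s * M) ^ e) :=
          h1.trans (add_le_add (add_le_add (hC _ (div_pos hs hM0)) le_rfl)
            (mul_le_mul_right (hC _ (mul_pos hs hM0)) _))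
      _ = ENNReal.ofReal (C * (M ^ (-e) + M ^ (-(q - e))) * s ^ e)
          + μ (Ioo (s / M) (s * M)) := by
          rw [add_right_comm, ← ENNReal.ofReal_mul (by positivity),
            ← ENNReal.ofReal_add (by positivity) (by positivity)]
          congr 2
          rw [Real.div_rpow hs.le hM0.le, Real.mul_rpow hs.le hM0.le, neg_sub,
            sub_eq_neg_add e q, Real.rpow_add hM0, Real.rpow_neg hM0.le e]
          field_simp
      _ ≤ _ := by gcongr
  have h3 : ENNReal.ofReal (c * s ^ e)
      = ENNReal.ofReal (c / 2 * s ^ e) + ENNReal.ofReal (c / 2 * s ^ e) := by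
    rw [← ENNReal.ofReal_add (by positivity) (by positivity)]
    congr 1
    ring
  rw [h3] at h2
  exact (ENNReal.add_le_add_iff_left ENNReal.ofReal_ne_top).1 h2

/-- Averaging of `μ` over the multiplicative group: Tonelli's theorem for `(s, t)` with
`s/M < t < sM`. -/
lemma lintegral_average {μ : Measure ℝ} [SFinite μ] (hμ : ∀ᵐ t ∂μ, 0 < t) {M : ℝ} (hM : 0 < M)
    {H : ℝ → ℝ≥0∞} (hH : Measurable H) :
    ∫⁻ s in Ioi (0 : ℝ), H s * μ (Ioo (s / M) (s * M))
      = ∫⁻ t, (∫⁻ s in Ioo (t / M) (t * M), H s) ∂μ := by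
  have hset : MeasurableSet {z : ℝ × ℝ | z.2 ∈ Ioo (z.1 / M) (z.1 * M)} :=
    (measurableSet_lt (measurable_fst.div_const M) measurable_snd).inter
      (measurableSet_lt measurable_snd (measurable_fst.mul_const M))
  have hm : Measurable (Function.uncurry fun s t : ℝ =>
      (Ioo (s / M) (s * M)).indicator (fun _ => H s) t) :=
    (hH.comp measurable_fst).indicator hset
  calc ∫⁻ s in Ioi (0 : ℝ), H s * μ (Ioo (s / M) (s * M))
      = ∫⁻ s in Ioi (0 : ℝ), ∫⁻ t, (Ioo (s / M) (s * M)).indicator (fun _ => H s) t ∂μ := by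
        simp only [lintegral_indicator_const measurableSet_Ioo]
    _ = ∫⁻ t, (∫⁻ s in Ioi (0 : ℝ), (Ioo (s / M) (s * M)).indicator (fun _ => H s) t) ∂μ :=
        lintegral_lintegral_swap hm.aemeasurable
    _ = ∫⁻ t, (∫⁻ s in Ioo (t / M) (t * M), H s) ∂μ := by
        refine lintegral_congr_ae (hμ.mono fun t ht => ?_)
        have hsub : Ioo (t / M) (t * M) ⊆ Ioi 0 := fun s hs => (div_pos ht hM).trans hs.1
        beta_reduce
        rw [← inter_eq_left.2 hsub, ← Measure.restrict_restrict measurableSet_Ioo,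
          ← lintegral_indicator measurableSet_Ioo]
        refine lintegral_congr fun s => ?_
        have : t ∈ Ioo (s / M) (s * M) ↔ s ∈ Ioo (t / M) (t * M) := by
          rw [mem_Ioo, mem_Ioo, div_lt_iff₀ hM, div_lt_iff₀ hM, and_comm]
        simp only [indicator_apply, this]

lemma lintegral_inv_Ioo_le {t M : ℝ} (ht : 0 < t) (hM : 0 < M) :
    ∫⁻ s in Ioo (t / M) (t * M), ENNReal.ofReal s⁻¹ ≤ ENNReal.ofReal (M * M) := by
  calc _ ≤ ∫⁻ _ in Ioo (t / M) (t * M), ENNReal.ofReal (M / t) := by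
        refine setLIntegral_mono' measurableSet_Ioo fun s hs => ENNReal.ofReal_le_ofReal ?_
        rw [← inv_div t M]
        exact inv_anti₀ (div_pos ht hM) hs.1.le
    _ ≤ _ := by
        rw [setLIntegral_const, Real.volume_Ioo, ← ENNReal.ofReal_mul (by positivity)]
        refine ENNReal.ofReal_le_ofReal ?_
        have h : M / t * (t * M - t / M) = M * M - 1 := by field_simp
        rw [h]
        linarith

lemma le_lintegral_inv_Ioo {t M : ℝ} (ht : 0 < t) (hM : 2 ≤ M) :
    ENNReal.ofReal (1 / 2) ≤ ∫⁻ s in Ioo (t / M) (t * M), ENNReal.ofReal s⁻¹ := by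
  have hM0 : 0 < M := by linarith
  calc _ ≤ ∫⁻ _ in Ioo (t / M) (t * M), ENNReal.ofReal (t * M)⁻¹ := by
        rw [setLIntegral_const, Real.volume_Ioo, ← ENNReal.ofReal_mul (by positivity)]
        refine ENNReal.ofReal_le_ofReal ?_
        have h : (t * M)⁻¹ * (t * M - t / M) = 1 - 1 / (M * M) := by field_simp
        have h2 : 1 / (M * M) ≤ 1 / 2 := one_div_le_one_div_of_le two_pos (by nlinarith)
        rw [h]
        linarith
    _ ≤ _ := setLIntegral_mono' measurableSet_Ioo fun s hs => ENNReal.ofReal_le_ofReal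
        (inv_anti₀ ((div_pos ht hM0).trans hs.1) hs.2.le)

/-- The average of `(f^{**})^q` against `ds/s` over `(t/M, tM)` is of the order of its value at
`t`. -/
lemma average_maxRearr {q : ℝ} (hq : 0 < q) (f : ℝ → ℝ) {t M : ℝ} (ht : 0 < t) (hM : 2 ≤ M) :
    ENNReal.ofReal (1 / 2) * maxRearr f t ^ q
        ≤ ENNReal.ofReal M ^ q *
          ∫⁻ s in Ioo (t / M) (t * M), maxRearr f s ^ q * ENNReal.ofReal s⁻¹ ∧
      ∫⁻ s in Ioo (t / M) (t * M), maxRearr f s ^ q * ENNReal.ofReal s⁻¹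
        ≤ ENNReal.ofReal M ^ q * ENNReal.ofReal (M * M) * maxRearr f t ^ q := by
  have hM0 : 0 < M := by linarith
  have hM1 : 1 ≤ M := by linarith
  have hinv : Measurable fun s : ℝ => ENNReal.ofReal s⁻¹ := measurable_inv.ennreal_ofReal
  have hG : Measurable fun s => maxRearr f s ^ q := (measurable_maxRearr f).pow_const q
  constructor
  · calc _ ≤ (∫⁻ s in Ioo (t / M) (t * M), ENNReal.ofReal s⁻¹) * maxRearr f t ^ q := by
          gcongr
          exact le_lintegral_inv_Ioo ht hM
      _ = ∫⁻ s in Ioo (t / M) (t * M), ENNReal.ofReal s⁻¹ * maxRearr f t ^ q :=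
          (lintegral_mul_const _ hinv).symm
      _ ≤ ∫⁻ s in Ioo (t / M) (t * M),
            ENNReal.ofReal M ^ q * (maxRearr f s ^ q * ENNReal.ofReal s⁻¹) := by
          refine setLIntegral_mono' measurableSet_Ioo fun s hs => ?_
          rw [← mul_assoc, mul_comm, ← ENNReal.mul_rpow_of_nonneg _ _ hq.le]
          gcongr
          exact maxRearr_le_mul f ht ((div_pos ht hM0).trans hs.1) hM1
            (by rw [mul_comm]; exact hs.2.le)
      _ = _ := lintegral_const_mul _ (hG.mul hinv)
  · calc _ ≤ ∫⁻ s in Ioo (t / M) (t * M),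
            ENNReal.ofReal M ^ q * maxRearr f t ^ q * ENNReal.ofReal s⁻¹ := by
          refine setLIntegral_mono' measurableSet_Ioo fun s hs => ?_
          rw [← ENNReal.mul_rpow_of_nonneg _ _ hq.le]
          gcongr
          refine maxRearr_le_mul f ((div_pos ht hM0).trans hs.1) ht hM1 ?_
          rw [mul_comm, ← div_le_iff₀ hM0]
          exact hs.1.le
      _ = ENNReal.ofReal M ^ q * maxRearr f t ^ q *
            ∫⁻ s in Ioo (t / M) (t * M), ENNReal.ofReal s⁻¹ := lintegral_const_mul _ hinv
      _ ≤ ENNReal.ofReal M ^ q * maxRearr f t ^ q * ENNReal.ofReal (M * M) := by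
          gcongr
          exact lintegral_inv_Ioo_le ht hM0
      _ = _ := by ring

/-- The characteristic functions of intervals determine the norm: when `μ` treats them as
`t^{q/p-1} dt` does, both measures have comparable masses on the intervals `(s/M, sM)`, and
`(f^{**})^q` is nearly constant there. -/
lemma exists_lintegral_comparison {p q c C : ℝ} {μ : Measure ℝ} [SFinite μ]
    (hμ : ∀ᵐ t ∂μ, 0 < t) (hp : 1 < p) (hq : 0 < q) (hc : 0 < c) (hC0 : 0 < C)
    (hcμ : ∀ a, 0 < a → ENNReal.ofReal (c * a ^ (q / p))
      ≤ ∫⁻ t, maxRearr (unitStep a) t ^ q ∂μ)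
    (hC : ∀ a, 0 < a → ∫⁻ t, maxRearr (unitStep a) t ^ q ∂μ
      ≤ ENNReal.ofReal (C * a ^ (q / p))) :
    ∃ K : ℝ≥0∞, K ≠ ∞ ∧ ∀ f,
      ∫⁻ t, maxRearr f t ^ q ∂μ ≤ K * ∫⁻ t, maxRearr f t ^ q ∂powerMeasure p q ∧
      ∫⁻ t, maxRearr f t ^ q ∂powerMeasure p q ≤ K * ∫⁻ t, maxRearr f t ^ q ∂μ := by
  have hp0 : 0 < p := zero_lt_one.trans hp
  obtain ⟨M, hM, hMμ⟩ := exists_le_measure_Ioo hq (div_pos hq hp0) (div_lt_self hq hp) hc hC0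
    hcμ hC
  have hM0 : 0 < M := by linarith
  set L : ℝ≥0∞ := ENNReal.ofReal M ^ q with hL
  have hLtop : L ≠ ∞ := ENNReal.rpow_ne_top_of_nonneg hq.le ENNReal.ofReal_ne_top
  set A : ℝ≥0∞ := ENNReal.ofReal (C * M ^ (q / p)) with hA
  have htwo : ENNReal.ofReal (1 / 2) ≠ 0 := by simp
  have hc2 : ENNReal.ofReal (c / 2) ≠ 0 := by simpa using hc
  have hinv : Measurable fun s : ℝ => ENNReal.ofReal s⁻¹ := measurable_inv.ennreal_ofReal
  refine ⟨(ENNReal.ofReal (1 / 2))⁻¹ * (L * A)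
      + (ENNReal.ofReal (c / 2))⁻¹ * (L * ENNReal.ofReal (M * M)), ?_, fun f => ?_⟩
  · exact ENNReal.add_ne_top.2 ⟨ENNReal.mul_ne_top (ENNReal.inv_ne_top.2 htwo)
      (ENNReal.mul_ne_top hLtop ENNReal.ofReal_ne_top),
      ENNReal.mul_ne_top (ENNReal.inv_ne_top.2 hc2)
      (ENNReal.mul_ne_top hLtop ENNReal.ofReal_ne_top)⟩
  have hG : Measurable fun s => maxRearr f s ^ q := (measurable_maxRearr f).pow_const q
  set I : ℝ≥0∞ := ∫⁻ t, maxRearr f t ^ q ∂μ with hI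
  set J : ℝ≥0∞ := ∫⁻ t, maxRearr f t ^ q ∂powerMeasure p q with hJ
  -- The two sides of `lintegral_average` are comparable with `J` and `I` respectively.
  set D : ℝ≥0∞ := ∫⁻ s in Ioi (0 : ℝ),
    maxRearr f s ^ q * ENNReal.ofReal s⁻¹ * μ (Ioo (s / M) (s * M)) with hD
  have hD' : D = ∫⁻ t, (∫⁻ s in Ioo (t / M) (t * M),
      maxRearr f s ^ q * ENNReal.ofReal s⁻¹) ∂μ := lintegral_average hμ hM0 (hG.mul hinv)
  have hpow : ∀ s ∈ Ioi (0 : ℝ), ∀ b : ℝ, 0 ≤ b →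
      ENNReal.ofReal b * (maxRearr f s ^ q * ENNReal.ofReal (s ^ (q / p - 1)))
        = maxRearr f s ^ q * ENNReal.ofReal s⁻¹ * ENNReal.ofReal (b * s ^ (q / p)) := by
    intro s hs b hb
    rw [mul_left_comm, mul_assoc, ← ENNReal.ofReal_mul hb,
      ← ENNReal.ofReal_mul (inv_nonneg.2 (mem_Ioi.1 hs).le), Real.rpow_sub hs, Real.rpow_one]
    congr 2
    ring
  have hJ' : J = ∫⁻ s in Ioi (0 : ℝ), maxRearr f s ^ q * ENNReal.ofReal (s ^ (q / p - 1)) :=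
    lintegral_powerMeasure p q hG
  have hDJ : D ≤ A * J := by
    rw [hJ', ← lintegral_const_mul' _ _ ENNReal.ofReal_ne_top]
    refine setLIntegral_mono' measurableSet_Ioi fun s hs => ?_
    rw [hpow s hs _ (by positivity)]
    gcongr
    exact measure_Ioo_le hM0 hC hs
  have hJD : ENNReal.ofReal (c / 2) * J ≤ D := by
    rw [hJ', ← lintegral_const_mul' _ _ ENNReal.ofReal_ne_top]
    refine setLIntegral_mono' measurableSet_Ioi fun s hs => ?_
    rw [hpow s hs _ (by positivity)]
    gcongr
    exact hMμ s hs
  have hID : ENNReal.ofReal (1 / 2) * I ≤ L * D := by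
    rw [hD', hI, ← lintegral_const_mul' _ _ ENNReal.ofReal_ne_top,
      ← lintegral_const_mul' _ _ hLtop]
    exact lintegral_mono_ae (hμ.mono fun t ht => (average_maxRearr hq f ht hM).1)
  have hDI : D ≤ L * ENNReal.ofReal (M * M) * I := by
    rw [hD', hI, ← lintegral_const_mul' _ _ (ENNReal.mul_ne_top hLtop ENNReal.ofReal_ne_top)]
    exact lintegral_mono_ae (hμ.mono fun t ht => (average_maxRearr hq f ht hM).2)
  have hcancel : ∀ {a x y : ℝ≥0∞}, a ≠ 0 → a ≠ ∞ → a * x ≤ y → x ≤ a⁻¹ * y := by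
    intro a x y h0 ht h
    calc x = a⁻¹ * (a * x) := by rw [← mul_assoc, ENNReal.inv_mul_cancel h0 ht, one_mul]
      _ ≤ a⁻¹ * y := by gcongr
  constructor
  · refine (hcancel htwo ENNReal.ofReal_ne_top (hID.trans (mul_le_mul_right hDJ L))).trans ?_
    rw [← mul_assoc L, ← mul_assoc]
    exact mul_le_mul_left le_self_add _
  · refine (hcancel hc2 ENNReal.ofReal_ne_top (hJD.trans hDI)).trans ?_
    rw [← mul_assoc]
    exact mul_le_mul_left le_add_self _

/-! ### Equivalence of functionals -/

lemma Equivalent.symm {A B : (ℝ → ℝ) → ℝ≥0∞} (h : Equivalent A B) : Equivalent B A := by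
  obtain ⟨C, hC, h⟩ := h
  exact ⟨C, hC, fun f hf => (h f hf).symm⟩

lemma Equivalent.trans {A B D : (ℝ → ℝ) → ℝ≥0∞} (h₁ : Equivalent A B) (h₂ : Equivalent B D) :
    Equivalent A D := by
  obtain ⟨C, hC, h⟩ := h₁
  obtain ⟨C', hC', h'⟩ := h₂
  refine ⟨C * C', mul_pos hC hC', fun f hf => ⟨?_, ?_⟩⟩
  · rw [ENNReal.coe_mul, mul_assoc]
    exact (h f hf).1.trans (mul_le_mul_right (h' f hf).1 _)
  · rw [ENNReal.coe_mul, mul_comm (C : ℝ≥0∞), mul_assoc]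
    exact (h' f hf).2.trans (mul_le_mul_right (h f hf).2 _)

lemma Equivalent.lt_top_iff {A B : (ℝ → ℝ) → ℝ≥0∞} (h : Equivalent A B) {f : ℝ → ℝ}
    (hf : AEMeasurable f halfLine) : A f < ∞ ↔ B f < ∞ := by
  obtain ⟨C, -, h⟩ := h
  exact ⟨fun hA => (h f hf).2.trans_lt (ENNReal.mul_lt_top ENNReal.coe_lt_top hA),
    fun hB => (h f hf).1.trans_lt (ENNReal.mul_lt_top ENNReal.coe_lt_top hB)⟩

lemma equivalent_of_le {A B : (ℝ → ℝ) → ℝ≥0∞} {C C' : ℝ≥0} (hC : 0 < C)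
    (h : ∀ f, AEMeasurable f halfLine → A f ≤ C * B f)
    (h' : ∀ f, AEMeasurable f halfLine → B f ≤ C' * A f) : Equivalent A B := by
  refine ⟨max C C', hC.trans_le (le_max_left _ _), fun f hf => ⟨(h f hf).trans ?_,
    (h' f hf).trans ?_⟩⟩
  · gcongr
    exact le_max_left _ _
  · gcongr
    exact le_max_right _ _

lemma equivalent_lorentzMaxNorm_lorentzNorm {p q : ℝ} (hp : 1 < p) (hq : 1 ≤ q) :
    Equivalent (lorentzMaxNorm p q) (lorentzNorm p q) := by
  obtain ⟨C, hC, h⟩ := exists_lorentzMaxNorm_le hp hq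
  refine equivalent_of_le (C' := 1) hC (fun f _ => h f) fun f _ => ?_
  rw [ENNReal.coe_one, one_mul]
  exact lorentzNorm_le_lorentzMaxNorm (zero_lt_one.trans_le hq) f

lemma IsRINorm.apply_unitStep_ne_zero {N : (ℝ → ℝ) → ℝ≥0∞} (hN : IsRINorm N) :
    N (unitStep 1) ≠ 0 := by
  rw [Ne, hN.eq_zero_iff _ (aemeasurable_unitStep 1)]
  intro h
  have h1 : ∀ᵐ x ∂halfLine, x ∉ Icc (0 : ℝ) 1 := by
    filter_upwards [h] with x hx hx1
    simp [unitStep, indicator_of_mem hx1] at hx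
  have h2 := measure_eq_zero_iff_ae_notMem.2 h1
  rw [halfLine_Icc] at h2
  simp at h2

lemma IsHomogeneousRINorm.apply_unitStep {p : ℝ} {N : (ℝ → ℝ) → ℝ≥0∞} (hN : IsHomogeneousRINorm p N)
    {a : ℝ} (ha : 0 < a) :
    N (unitStep a) = ENNReal.ofReal (a ^ (1 / p)) * N (unitStep 1) := by
  have hfin : N (unitStep 1) < ∞ :=
    hN.isRINorm.indicator_lt_top _ measurableSet_Icc.nullMeasurableSet
      (by rw [halfLine_Icc]; exact ENNReal.ofReal_lt_top)
  rw [← dilation_unitStep ha, hN.homogeneous _ (aemeasurable_unitStep 1) hfin _ (inv_pos.2 ha),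
    inv_rpow_neg_one_div ha]

lemma maxNorm_rpow {q : ℝ} (hq : 0 < q) (μ : Measure ℝ) (f : ℝ → ℝ) :
    maxNorm q μ f ^ q = ∫⁻ t, maxRearr f t ^ q ∂μ := by
  rw [maxNorm, ← ENNReal.rpow_mul, one_div_mul_cancel hq.ne', ENNReal.rpow_one]

/-- Only the values of `N` on characteristic functions of intervals enter. -/
lemma equivalent_maxNorm_of_homogeneous {p q : ℝ} (hp : 1 < p) (hq : 0 < q) {μ : Measure ℝ}
    [SFinite μ] (hμ : ∀ᵐ t ∂μ, 0 < t) {N : (ℝ → ℝ) → ℝ≥0∞} (hN : IsHomogeneousRINorm p N)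
    (h : Equivalent (maxNorm q μ) N) :
    Equivalent (maxNorm q μ) (maxNorm q (powerMeasure p q)) := by
  obtain ⟨B, hB, hBN⟩ := h
  have hfin : N (unitStep 1) ≠ ∞ :=
    (hN.isRINorm.indicator_lt_top _ measurableSet_Icc.nullMeasurableSet
      (by rw [halfLine_Icc]; exact ENNReal.ofReal_lt_top)).ne
  let n : ℝ := (N (unitStep 1)).toReal
  have hn : 0 < n := ENNReal.toReal_pos hN.isRINorm.apply_unitStep_ne_zero hfin
  have hNa : ∀ a, 0 < a → N (unitStep a) = ENNReal.ofReal (n * a ^ (1 / p)) := fun a ha => by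
    rw [hN.apply_unitStep ha, mul_comm n, ENNReal.ofReal_mul (by positivity),
      ENNReal.ofReal_toReal hfin]
  have hBr : (0 : ℝ) < B := hB
  have hpow : ∀ a : ℝ, 0 < a → ∀ b : ℝ, 0 ≤ b →
      ENNReal.ofReal (b ^ q * a ^ (q / p)) = ENNReal.ofReal (b * a ^ (1 / p)) ^ q := by
    intro a ha b hb
    rw [ENNReal.ofReal_rpow_of_nonneg (by positivity) hq.le, Real.mul_rpow hb (by positivity),
      ← Real.rpow_mul ha.le, one_div_mul_eq_div]
  obtain ⟨K, hK, hcomp⟩ := exists_lintegral_comparison (c := ((B : ℝ)⁻¹ * n) ^ q)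
    (C := (B * n) ^ q) hμ hp hq (by positivity) (by positivity)
    (fun a ha => by
      rw [hpow a ha _ (by positivity), ← maxNorm_rpow hq]
      refine ENNReal.rpow_le_rpow ?_ hq.le
      have h1 := (hBN _ (aemeasurable_unitStep a)).2
      rw [hNa a ha] at h1
      rw [mul_assoc, ENNReal.ofReal_mul (by positivity), ENNReal.ofReal_inv_of_pos hBr,
        ENNReal.ofReal_coe_nnreal]
      calc _ ≤ (B : ℝ≥0∞)⁻¹ * (B * maxNorm q μ (unitStep a)) := by gcongr
        _ = _ := by
          rw [← mul_assoc, ENNReal.inv_mul_cancel (by simpa using hB.ne') ENNReal.coe_ne_top,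
            one_mul])
    (fun a ha => by
      rw [hpow a ha _ (by positivity), ← maxNorm_rpow hq]
      refine ENNReal.rpow_le_rpow ?_ hq.le
      have h1 := (hBN _ (aemeasurable_unitStep a)).1
      rwa [hNa a ha, ← ENNReal.ofReal_coe_nnreal, ← ENNReal.ofReal_mul hBr.le,
        ← mul_assoc] at h1)
  have hKq : K ^ (1 / q) ≠ ∞ := ENNReal.rpow_ne_top_of_nonneg (by positivity) hK
  have hle : ∀ {x y : ℝ≥0∞}, x ≤ K * y →
      x ^ (1 / q) ≤ ((K ^ (1 / q)).toNNReal + 1 : ℝ≥0) * y ^ (1 / q) := by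
    intro x y hxy
    rw [ENNReal.coe_add, ENNReal.coe_toNNReal hKq]
    calc x ^ (1 / q) ≤ (K * y) ^ (1 / q) := ENNReal.rpow_le_rpow hxy (by positivity)
      _ = K ^ (1 / q) * y ^ (1 / q) := ENNReal.mul_rpow_of_nonneg _ _ (by positivity)
      _ ≤ _ := mul_le_mul_left le_self_add _
  exact ⟨(K ^ (1 / q)).toNNReal + 1, by positivity, fun f _ =>
    ⟨hle (hcomp f).1, hle (hcomp f).2⟩⟩

/-- For the zero weight the space would contain the constant function `1`, which dominates all
characteristic functions of intervals and is therefore not in the Lorentz space. -/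
lemma weightMeasure_ne_zero_of_subset {p q : ℝ} (hp : 1 < p) (hq : 0 < q) {w : ℝ → ℝ}
    (h : ∀ f, AEMeasurable f halfLine → maxNorm q (weightMeasure w) f < ∞ →
      maxNorm q (powerMeasure p q) f < ∞) : weightMeasure w ≠ 0 := by
  intro h0
  have h1 := h (fun _ => 1) aemeasurable_const (by
    rw [h0, maxNorm, lintegral_zero_measure, ENNReal.zero_rpow_of_pos (by positivity)]
    exact ENNReal.zero_lt_top)
  have h2 : ∀ a, 0 < a → ENNReal.ofReal (a ^ (1 / p)) *
      maxNorm q (powerMeasure p q) (unitStep 1) ≤ maxNorm q (powerMeasure p q) fun _ => 1 := by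
    intro a ha
    rw [← maxNorm_powerMeasure_unitStep hq ha]
    refine maxNorm_mono hq (Eventually.of_forall fun x => ?_)
    by_cases hx : x ∈ Icc 0 a <;> simp [unitStep, hx]
  have h3 : Tendsto (fun a : ℝ => ENNReal.ofReal (a ^ (1 / p)) *
      maxNorm q (powerMeasure p q) (unitStep 1)) atTop (𝓝 ∞) := by
    have h4 := ENNReal.Tendsto.mul_const (b := maxNorm q (powerMeasure p q) (unitStep 1))
      (ENNReal.tendsto_ofReal_atTop.comp
        (tendsto_rpow_atTop (one_div_pos.2 (zero_lt_one.trans hp)))) (Or.inl ENNReal.top_ne_zero)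
    have h5 : maxNorm q (powerMeasure p q) (unitStep 1) ≠ 0 :=
      maxNorm_unitStep_ne_zero hq (powerMeasure_ne_zero p q) one_pos
    rwa [ENNReal.top_mul h5] at h4
  exact not_top_lt ((le_of_tendsto h3 ((eventually_gt_atTop 0).mono h2)).trans_lt h1)

lemma equivalent_maxNorm_of_space_eq {p q : ℝ} (hp : 1 < p) (hq : 1 ≤ q) {w : ℝ → ℝ}
    (h : ∀ f, AEMeasurable f halfLine → (maxNorm q (weightMeasure w) f < ∞ ↔
      maxNorm q (powerMeasure p q) f < ∞)) :
    Equivalent (maxNorm q (weightMeasure w)) (maxNorm q (powerMeasure p q)) := by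
  have hq0 : 0 < q := zero_lt_one.trans_le hq
  have hw := weightMeasure_ne_zero_of_subset hp hq0 fun f hf => (h f hf).1
  obtain ⟨C, hC, h1⟩ := exists_maxNorm_le_of_subset hq (ν := weightMeasure w)
    (fun _ => maxNorm_unitStep_ne_zero hq0 (powerMeasure_ne_zero p q)) fun f hf => (h f hf).2
  obtain ⟨C', -, h2⟩ := exists_maxNorm_le_of_subset hq (ν := powerMeasure p q)
    (fun _ => maxNorm_unitStep_ne_zero hq0 hw) fun f hf => (h f hf).1
  exact equivalent_of_le hC h1 h2

end RILorentz

end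

theorem proposition3p3 (p q : ℝ) (hp : 1 < p) (hq : 1 ≤ q) (w : ℝ → ℝ)
    (hw : RILorentz.IsWeight w) :
    ((∃ N : (ℝ → ℝ) → ENNReal, RILorentz.IsHomogeneousRINorm p N ∧
        RILorentz.Equivalent (RILorentz.gammaNorm q w) N) ↔
      RILorentz.Equivalent (RILorentz.gammaNorm q w) (RILorentz.lorentzNorm p q)) ∧
    (RILorentz.Equivalent (RILorentz.gammaNorm q w) (RILorentz.lorentzNorm p q) ↔
      RILorentz.gammaSpace q w = RILorentz.lorentzSpace p q) := by
  have hq0 : 0 < q := zero_lt_one.trans_le hq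
  have hL := RILorentz.equivalent_lorentzMaxNorm_lorentzNorm hp hq
  have hiff : RILorentz.Equivalent (RILorentz.gammaNorm q w) (RILorentz.lorentzNorm p q) ↔
      RILorentz.Equivalent (RILorentz.gammaNorm q w) (RILorentz.lorentzMaxNorm p q) :=
    ⟨fun h => h.trans hL.symm, fun h => h.trans hL⟩
  have hspace : RILorentz.gammaSpace q w = RILorentz.lorentzSpace p q ↔
      ∀ f, AEMeasurable f RILorentz.halfLine →
        (RILorentz.gammaNorm q w f < ∞ ↔ RILorentz.lorentzMaxNorm p q f < ∞) := by
    simp only [Set.ext_iff, RILorentz.gammaSpace, RILorentz.lorentzSpace, Set.mem_ofPred_eq,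
      and_congr_right_iff]
  rw [hiff, hspace, RILorentz.gammaNorm_eq hw, RILorentz.lorentzMaxNorm_eq]
  refine ⟨⟨?_, fun h => ⟨_, RILorentz.isHomogeneousRINorm_maxNorm hp hq, h⟩⟩,
    fun h f hf => h.lt_top_iff hf, RILorentz.equivalent_maxNorm_of_space_eq hp hq⟩
  rintro ⟨N, hN, h⟩
  exact RILorentz.equivalent_maxNorm_of_homogeneous hp hq0 (RILorentz.ae_weightMeasure_pos w) hN h
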